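/- Let $(X,\|\cdot\|)$ be a real Banach space with dual space $X^*$, equipped with its canonical dual norm. A topological space $Y$ is called a Gruenhage space if there are families $\mathscr{U}_n$ ($n\in\mathbb{N}$) of open subsets of $Y$ such that for all distinct $x,y\in Y$ there exist $n\in\mathbb{N}$ and $U\in\mathscr{U}_n$ for which $U\cap\{x,y\}$ is a singleton and at least one of $x$, $y$ lies in only finitely many members of $\mathscr{U}_n$. Let $K\subseteq X^*$ be $w^*$-compact and, in the relative $w^*$-topology, a Gruenhage space. Let $|||\cdot|||$ be a norm on $X^*$ that is equivalent to some norm $p$ on $X^*$, where $p$ is $w^*$-lower semicontinuous and coarser than the dual norm, i.e. $p(f)\le C\|f\|$ for some constant $C>0$ and all $f\in X^*$. Suppose that $X^*$ is the $|||\cdot|||$-closure of the linear span of $K$. Then $X^*$ admits an equivalent, strictly convex dual norm: there is a norm $N$ on $X$, equivalent to $\|\cdot\|$, such that the dual norm $|f|=\sup\{f(x): x\in X,\ N(x)\le 1\}$ on $X^*$ is equivalent to the canonical dual norm and satisfies: $|f|=|g|=\tfrac12|f+g|$ implies $f=g$. -/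

import Mathlib

namespace Renorming

/-- A topological space `Y` is a Gruenhage space: there are families `𝒰 n` of open sets such that
for distinct `x, y` there are `n` and `U ∈ 𝒰 n` with `U ∩ {x, y}` a singleton, and one of `x`, `y`
lies in only finitely many members of `𝒰 n`. -/
def IsGruenhageSpace (Y : Type*) [TopologicalSpace Y] : Prop :=
  ∃ 𝒰 : ℕ → Set (Set Y),
    (∀ n, ∀ U ∈ 𝒰 n, IsOpen U) ∧
    ∀ x y : Y, x ≠ y → ∃ n, ∃ U ∈ 𝒰 n,
      (∃ z, U ∩ {x, y} = {z}) ∧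
      ({V ∈ 𝒰 n | x ∈ V}.Finite ∨ {V ∈ 𝒰 n | y ∈ V}.Finite)

section Norms

variable {E : Type*} [AddCommGroup E] [Module ℝ E]

/-- A seminorm that is a norm. -/
def IsNorm (p : Seminorm ℝ E) : Prop :=
  ∀ x, p x = 0 → x = 0

/-- `p` is coarser than `q`: it is dominated by a multiple of `q`. -/
def IsCoarser (p q : Seminorm ℝ E) : Prop :=
  ∃ C : ℝ, 0 < C ∧ ∀ x, p x ≤ C * q x

/-- `p` and `q` are equivalent: each is dominated by a multiple of the other. -/
def AreEquivalent (p q : Seminorm ℝ E) : Prop :=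
  IsCoarser p q ∧ IsCoarser q p

/-- Strict convexity: `p x = p y = p (x + y) / 2` forces `x = y`. -/
def IsStrictlyConvex (p : Seminorm ℝ E) : Prop :=
  ∀ x y, p x = p y → p y = p (x + y) / 2 → x = y

/-- `E` is the closure of the linear span of `S` for the seminorm `p`. -/
def IsClosedSpan (p : Seminorm ℝ E) (S : Set E) : Prop :=
  ∀ x, ∀ ε : ℝ, 0 < ε → ∃ y ∈ Submodule.span ℝ S, p (x - y) < ε

end Norms

section Dual

variable {X : Type*} [NormedAddCommGroup X] [NormedSpace ℝ X]

/-- Lower semicontinuity, for the `w*`-topology, of a seminorm on the dual space. -/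
def IsWeakStarLSC (p : Seminorm ℝ (StrongDual ℝ X)) : Prop :=
  LowerSemicontinuous fun f : WeakDual ℝ X => p (WeakDual.toStrongDual f)

/-- A subset of the dual space is a Gruenhage compact in the `w*`-topology. -/
def IsWeakStarGruenhageCompact (K : Set (StrongDual ℝ X)) : Prop :=
  IsCompact (StrongDual.toWeakDual '' K : Set (WeakDual ℝ X)) ∧
    IsGruenhageSpace (StrongDual.toWeakDual '' K : Set (WeakDual ℝ X))

/-- `D` is an equivalent dual norm on the dual space: it is equivalent to the canonical norm, and
there is a norm `N` on `X`, equivalent to the given one, whose dual norm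
`f ↦ sup {f x | N x ≤ 1}` is `D`. -/
def IsEquivalentDualNorm (D : Seminorm ℝ (StrongDual ℝ X)) : Prop :=
  AreEquivalent D (normSeminorm ℝ (StrongDual ℝ X)) ∧
    ∃ N : Seminorm ℝ X, AreEquivalent N (normSeminorm ℝ X) ∧
      ∀ f : StrongDual ℝ X, IsLUB {r : ℝ | ∃ x, N x ≤ 1 ∧ r = f x} (D f)

end Dual

end Renorming

/-! Strict convexity is produced on the positive measures on `K` and then carried to the dual. Under
the barycenter map `T` the Dirac measure at a point of `K` goes to that point, so the differences `T
μ - T ν` of images of positive measures cover the span of `K`, which is dense for `p`.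

On the cone of positive functionals on `C(K, ℝ)`, the Gruenhage families give countably many systems
of disjoint atoms `W \ root`, with `W` and `root` open, that separate points. The mass of an open
set is `w*`-lower semicontinuous, hence so are `μ root` and the supremum of the sums of `μ W` over
at most `k` members. If these values agree for `μ` and `ν` and double for `μ + ν`, then finite
superlevel sets of `μ + ν` are maximal for `μ` and `ν` as well, and `μ`, `ν` agree on all atoms
(`eq_of_supSum_smallFinsets_eq`). Using finite products of systems too, they agree on finite
intersections of atoms, and a Lusin-type argument yields `μ = ν` (`OpenSystem.measure_eq_of_atoms`).
A weighted sum of squares of these functionals is a strictly convex energy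
(`exists_isStrictEnergy`), and the energies of the two parts of a pair `(μ, ν)` add up to a penalty
`Ψ`.

Let `G n f` be the minimum over `z` of `p (f - τ z) ^ 2 + Ψ z / (n + 1)`, with `τ (μ, ν) = T μ - T
ν`. Midpoint equality for `G n` at `f`, `g` makes their minimisers coincide, whence `p (f - g) ≤ √(G
n f) + √(G n g)`; by density the right side tends to `0`. So `‖f‖ ^ 2 + ∑ 2⁻ⁿ G n f` is the square
of a strictly convex norm. Compact sublevel sets of `Ψ` make it `w*`-lower semicontinuous, and
Hahn–Banach separation makes it a dual norm. -/

open MeasureTheory Set Filter Topology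
open scoped ENNReal NNReal CompactlySupported

namespace Renorming

/-! ### Positive functionals on `C(K, ℝ)` and their representing measures. -/

section PositiveFunctionals

variable (K : Type*) [TopologicalSpace K]

/-- The cone of positive functionals on `C(K, ℝ)`. -/
def positiveCone : Set (WeakDual ℝ C(K, ℝ)) :=
  {Λ | ∀ g : C(K, ℝ), 0 ≤ g → 0 ≤ Λ g}

variable {K}

theorem isClosed_positiveCone : IsClosed (positiveCone K) := by
  simp only [positiveCone, ofPred_forall]
  exact isClosed_iInter fun g => isClosed_iInter fun _ =>
    isClosed_le continuous_const (WeakDual.eval_continuous g)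

theorem add_mem_positiveCone {Λ Γ : WeakDual ℝ C(K, ℝ)} (hΛ : Λ ∈ positiveCone K)
    (hΓ : Γ ∈ positiveCone K) : Λ + Γ ∈ positiveCone K :=
  fun g hg => add_nonneg (hΛ g hg) (hΓ g hg)

theorem smul_mem_positiveCone {Λ : WeakDual ℝ C(K, ℝ)} (hΛ : Λ ∈ positiveCone K) {c : ℝ}
    (hc : 0 ≤ c) : c • Λ ∈ positiveCone K :=
  fun g hg => mul_nonneg hc (hΛ g hg)

theorem convex_positiveCone : Convex ℝ (positiveCone K) :=
  fun _ hx _ hy _ _ ha hb _ =>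
    add_mem_positiveCone (smul_mem_positiveCone hx ha) (smul_mem_positiveCone hy hb)

theorem mono_of_mem_positiveCone {Λ : WeakDual ℝ C(K, ℝ)} (hΛ : Λ ∈ positiveCone K)
    {g h : C(K, ℝ)} (hgh : g ≤ h) : Λ g ≤ Λ h := by
  have := hΛ (h - g) (sub_nonneg.2 hgh)
  rwa [map_sub, sub_nonneg] at this

variable [CompactSpace K]

theorem norm_toStrongDual_le_of_mem_positiveCone {Λ : WeakDual ℝ C(K, ℝ)}
    (hΛ : Λ ∈ positiveCone K) : ‖WeakDual.toStrongDual Λ‖ ≤ Λ 1 := by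
  refine ContinuousLinearMap.opNorm_le_bound _ (hΛ 1 zero_le_one) fun g => ?_
  have h1 : Λ g ≤ Λ (‖g‖ • 1) := mono_of_mem_positiveCone hΛ fun x => by
    simpa using (le_abs_self _).trans (g.norm_coe_le_norm x)
  have h2 : Λ (-(‖g‖ • 1)) ≤ Λ g := mono_of_mem_positiveCone hΛ fun x => by
    simpa using (abs_le.1 (g.norm_coe_le_norm x)).1
  rw [map_neg, map_smul, smul_eq_mul] at h2
  rw [map_smul, smul_eq_mul] at h1
  rw [WeakDual.toStrongDual_apply, Real.norm_eq_abs, abs_le]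
  constructor <;> linarith

variable [MeasurableSpace K] [BorelSpace K]

theorem integrable_continuousMap (μ : Measure K) [IsFiniteMeasure μ] (g : C(K, ℝ)) :
    Integrable g μ :=
  g.continuous.integrable_of_hasCompactSupport (HasCompactSupport.of_compactSpace g)

variable [T2Space K]

theorem exists_regular_measure_of_mem_positiveCone {Λ : WeakDual ℝ C(K, ℝ)}
    (hΛ : Λ ∈ positiveCone K) :
    ∃ μ : Measure K, μ.Regular ∧ IsFiniteMeasure μ ∧ ∀ g : C(K, ℝ), ∫ x, g x ∂μ = Λ g := by
  let L : C_c(K, ℝ) →ₚ[ℝ] ℝ := PositiveLinearMap.mk₀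
    { toFun := fun g => Λ (g : C(K, ℝ))
      map_add' := fun g h => map_add Λ (g : C(K, ℝ)) (h : C(K, ℝ))
      map_smul' := fun c g => map_smul Λ c (g : C(K, ℝ)) } fun g hg => hΛ _ hg
  refine ⟨RealRMK.rieszMeasure L, inferInstance, inferInstance, fun g => ?_⟩
  exact RealRMK.integral_rieszMeasure L (CompactlySupportedContinuousMap.continuousMapEquiv g)

open Classical in
/-- The regular measure that represents a positive functional on `C(K, ℝ)`. -/
noncomputable def reprMeasure (Λ : WeakDual ℝ C(K, ℝ)) : Measure K :=
  if hΛ : Λ ∈ positiveCone K then (exists_regular_measure_of_mem_positiveCone hΛ).choose else 0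

instance (Λ : WeakDual ℝ C(K, ℝ)) : (reprMeasure Λ).Regular := by
  unfold reprMeasure
  split_ifs with h
  · exact (exists_regular_measure_of_mem_positiveCone h).choose_spec.1
  · infer_instance

instance (Λ : WeakDual ℝ C(K, ℝ)) : IsFiniteMeasure (reprMeasure Λ) := by
  unfold reprMeasure
  split_ifs with h
  · exact (exists_regular_measure_of_mem_positiveCone h).choose_spec.2.1
  · infer_instance

theorem integral_reprMeasure {Λ : WeakDual ℝ C(K, ℝ)} (hΛ : Λ ∈ positiveCone K) (g : C(K, ℝ)) :
    ∫ x, g x ∂reprMeasure Λ = Λ g := by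
  rw [reprMeasure, dif_pos hΛ]
  exact (exists_regular_measure_of_mem_positiveCone hΛ).choose_spec.2.2 g

theorem eq_reprMeasure {Λ : WeakDual ℝ C(K, ℝ)} (hΛ : Λ ∈ positiveCone K) {μ : Measure K}
    [μ.Regular] (h : ∀ g : C(K, ℝ), ∫ x, g x ∂μ = Λ g) : μ = reprMeasure Λ :=
  Measure.ext_of_integral_eq_on_compactlySupported fun g =>
    (h (g : C(K, ℝ))).trans (integral_reprMeasure hΛ (g : C(K, ℝ))).symm

theorem reprMeasure_add {Λ Γ : WeakDual ℝ C(K, ℝ)} (hΛ : Λ ∈ positiveCone K)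
    (hΓ : Γ ∈ positiveCone K) :
    reprMeasure (Λ + Γ) = reprMeasure Λ + reprMeasure Γ := by
  refine (eq_reprMeasure (add_mem_positiveCone hΛ hΓ) fun g => ?_).symm
  rw [integral_add_measure (integrable_continuousMap _ g) (integrable_continuousMap _ g),
    integral_reprMeasure hΛ, integral_reprMeasure hΓ]
  rfl

theorem reprMeasure_smul {Λ : WeakDual ℝ C(K, ℝ)} (hΛ : Λ ∈ positiveCone K) {c : ℝ}
    (hc : 0 ≤ c) : reprMeasure (c • Λ) = ENNReal.ofReal c • reprMeasure Λ := by
  have := Measure.Regular.smul (μ := reprMeasure Λ) (x := ENNReal.ofReal c) ENNReal.ofReal_ne_top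
  refine (eq_reprMeasure (smul_mem_positiveCone hΛ hc) fun g => ?_).symm
  rw [integral_smul_measure, integral_reprMeasure hΛ, ENNReal.toReal_ofReal hc]
  rfl

theorem eq_of_reprMeasure_eq {Λ Γ : WeakDual ℝ C(K, ℝ)} (hΛ : Λ ∈ positiveCone K)
    (hΓ : Γ ∈ positiveCone K) (h : reprMeasure Λ = reprMeasure Γ) : Λ = Γ :=
  DFunLike.ext _ _ fun g => by rw [← integral_reprMeasure hΛ, h, integral_reprMeasure hΓ]

theorem reprMeasure_real_univ {Λ : WeakDual ℝ C(K, ℝ)} (hΛ : Λ ∈ positiveCone K) :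
    (reprMeasure Λ).real univ = Λ 1 := by
  rw [← integral_reprMeasure hΛ]; simp

/-- By inner regularity and Urysohn's lemma, the mass of `U` is a supremum of values `Λ g` with `0 ≤
g ≤ 1` and `g = 0` off `U`, and each `Λ ↦ Λ g` is `w*`-continuous. -/
theorem lowerSemicontinuousOn_reprMeasure_real {U : Set K} (hU : IsOpen U) :
    LowerSemicontinuousOn (fun Λ => (reprMeasure Λ).real U) (positiveCone K) := by
  intro Λ hΛ r hr
  rcases lt_or_ge r 0 with hr0 | hr0
  · exact Eventually.of_forall fun _ => hr0.trans_le measureReal_nonneg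
  have hr' : ENNReal.ofReal r < reprMeasure Λ U := by
    rwa [ENNReal.ofReal_lt_iff_lt_toReal hr0 (measure_ne_top _ _)]
  obtain ⟨C, hCU, hC, hrC⟩ := hU.exists_lt_isCompact hr'
  obtain ⟨g, hg1, hg0, hg⟩ := exists_continuous_zero_one_of_isClosed hU.isClosed_compl
    hC.isClosed (disjoint_left.2 fun x hx hxC => hx (hCU hxC))
  have hrg : r < Λ g := by
    rw [ENNReal.ofReal_lt_iff_lt_toReal hr0 (measure_ne_top _ _)] at hrC
    refine hrC.trans_le ?_
    rw [← integral_reprMeasure hΛ, ← measureReal_def, ← integral_indicator_one hC.measurableSet]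
    refine integral_mono ((integrable_const 1).indicator hC.measurableSet)
      (integrable_continuousMap _ g) fun x => ?_
    by_cases hx : x ∈ C
    · simp [hx, hg0 hx]
    · simpa [hx] using (hg x).1
  filter_upwards [nhdsWithin_le_nhds ((WeakDual.eval_continuous g).continuousAt.eventually_const_lt
    hrg), self_mem_nhdsWithin] with Γ hΓg hΓ
  refine hΓg.trans_le ?_
  rw [← integral_reprMeasure hΓ, ← integral_indicator_one hU.measurableSet]
  refine integral_mono (integrable_continuousMap _ g)
    ((integrable_const 1).indicator hU.measurableSet) fun x => ?_
  by_cases hx : x ∈ U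
  · simpa [hx] using (hg x).2
  · simp [hx, hg1 (show x ∈ Uᶜ from hx)]

end PositiveFunctionals

/-! ### Suprema of sums over small finite sets. -/

section TopSums

variable {ι : Type*}

/-- After cancelling `F ∩ G`, the threshold `t` separates the remaining terms, and `F \ G` has no
more elements than `G \ F`. -/
theorem sum_le_sum_of_superlevel [DecidableEq ι] {c : ι → ℝ} {t : ℝ} (ht : 0 ≤ t) {F G : Finset ι}
    (hG : ∀ i ∈ G, t ≤ c i) (hF : ∀ i ∈ F, i ∉ G → c i ≤ t) (hcard : F.card ≤ G.card) :
    ∑ i ∈ F, c i ≤ ∑ i ∈ G, c i := by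
  rw [← Finset.sum_inter_add_sum_sdiff F G, ← Finset.sum_inter_add_sum_sdiff G F,
    Finset.inter_comm G F]
  have h1 : ∑ i ∈ F \ G, c i ≤ (F \ G).card • t := Finset.sum_le_card_nsmul _ _ _ fun i hi =>
    hF i (Finset.mem_sdiff.1 hi).1 (Finset.mem_sdiff.1 hi).2
  have h2 : (G \ F).card • t ≤ ∑ i ∈ G \ F, c i := Finset.card_nsmul_le_sum _ _ _ fun i hi =>
    hG i (Finset.mem_sdiff.1 hi).1
  have h3 : (F \ G).card • t ≤ (G \ F).card • t :=
    nsmul_le_nsmul_left ht (Finset.card_sdiff_le_card_sdiff_iff.2 hcard)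
  linarith

/-- The supremum of the sums of `a` over the members of a collection of finite sets. -/
noncomputable def supSum (𝓕 : Set (Finset ι)) (a : ι → ℝ) : ℝ :=
  ⨆ F : 𝓕, ∑ i ∈ F.1, a i

/-- The finite subsets of `S` with at most `k` elements. -/
def smallFinsets (S : Set ι) (k : ℕ) : Set (Finset ι) :=
  {F | (F : Set ι) ⊆ S ∧ F.card ≤ k}

theorem sum_le_supSum {𝓕 : Set (Finset ι)} {a : ι → ℝ}
    (ha : BddAbove (range fun F : 𝓕 => ∑ i ∈ F.1, a i)) {F : Finset ι} (hF : F ∈ 𝓕) :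
    ∑ i ∈ F, a i ≤ supSum 𝓕 a :=
  le_ciSup ha ⟨F, hF⟩

theorem bddAbove_range_sum {𝓕 : Set (Finset ι)} {k : ℕ} (h𝓕 : ∀ F ∈ 𝓕, F.card ≤ k) {a : ι → ℝ}
    {M : ℝ} (hM : 0 ≤ M) (ha : ∀ i, a i ≤ M) :
    BddAbove (range fun F : 𝓕 => ∑ i ∈ F.1, a i) := by
  refine ⟨k * M, ?_⟩
  rintro _ ⟨F, rfl⟩
  refine (Finset.sum_le_card_nsmul _ _ M fun i _ => ha i).trans ?_
  rw [nsmul_eq_mul]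
  gcongr
  exact h𝓕 _ F.2

theorem supSum_le {𝓕 : Set (Finset ι)} {k : ℕ} (h𝓕 : ∀ F ∈ 𝓕, F.card ≤ k) {a : ι → ℝ}
    {M : ℝ} (hM : 0 ≤ M) (ha : ∀ i, a i ≤ M) : supSum 𝓕 a ≤ k * M := by
  refine Real.iSup_le (fun F => ?_) (by positivity)
  refine (Finset.sum_le_card_nsmul _ _ M fun i _ => ha i).trans ?_
  rw [nsmul_eq_mul]
  gcongr
  exact h𝓕 _ F.2

theorem supSum_nonneg (𝓕 : Set (Finset ι)) {a : ι → ℝ} (ha : ∀ i, 0 ≤ a i) : 0 ≤ supSum 𝓕 a :=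
  Real.iSup_nonneg fun _ => Finset.sum_nonneg fun i _ => ha i

theorem supSum_add_le {𝓕 : Set (Finset ι)} {a b : ι → ℝ} (ha0 : ∀ i, 0 ≤ a i)
    (hb0 : ∀ i, 0 ≤ b i) (ha : BddAbove (range fun F : 𝓕 => ∑ i ∈ F.1, a i))
    (hb : BddAbove (range fun F : 𝓕 => ∑ i ∈ F.1, b i)) :
    supSum 𝓕 (a + b) ≤ supSum 𝓕 a + supSum 𝓕 b := by
  refine Real.iSup_le (fun F => ?_) (add_nonneg (supSum_nonneg _ ha0) (supSum_nonneg _ hb0))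
  simp only [Pi.add_apply, Finset.sum_add_distrib]
  exact add_le_add (sum_le_supSum ha F.2) (sum_le_supSum hb F.2)

theorem supSum_smul (𝓕 : Set (Finset ι)) (a : ι → ℝ) {c : ℝ} (hc : 0 ≤ c) :
    supSum 𝓕 (c • a) = c * supSum 𝓕 a := by
  simp only [supSum, Real.mul_iSup_of_nonneg hc, Finset.mul_sum, Pi.smul_apply, smul_eq_mul]

/-- A set that is maximal for `a + b` must be maximal for `a` and for `b` separately, since the
suprema add up without loss. -/
theorem sum_eq_sum_of_supSum_eq {𝓕 : Set (Finset ι)} {a b : ι → ℝ}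
    (ha : BddAbove (range fun F : 𝓕 => ∑ i ∈ F.1, a i))
    (hb : BddAbove (range fun F : 𝓕 => ∑ i ∈ F.1, b i)) (hab : supSum 𝓕 a = supSum 𝓕 b)
    (hadd : supSum 𝓕 (a + b) = 2 * supSum 𝓕 a) {G : Finset ι} (hG : G ∈ 𝓕)
    (hmax : ∀ F ∈ 𝓕, ∑ i ∈ F, (a + b) i ≤ ∑ i ∈ G, (a + b) i) :
    ∑ i ∈ G, a i = ∑ i ∈ G, b i := by
  have h1 := sum_le_supSum ha hG
  have h2 := sum_le_supSum hb hG
  have : Nonempty 𝓕 := ⟨⟨G, hG⟩⟩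
  have h3 : supSum 𝓕 (a + b) ≤ ∑ i ∈ G, (a + b) i := ciSup_le fun F => hmax _ F.2
  simp only [Pi.add_apply, Finset.sum_add_distrib] at h3
  linarith

/-- If `a`, `b` and `a + b` have the same `k`-fold top sums, up to the obvious factor, for all `k`,
then `a` and `b` agree at every point where the superlevel set of `a + b` is finite. -/
theorem eq_of_supSum_smallFinsets_eq {S : Set ι} {a b : ι → ℝ} (ha0 : ∀ i, 0 ≤ a i)
    (hb0 : ∀ i, 0 ≤ b i)
    (ha : ∀ k, BddAbove (range fun F : smallFinsets S k => ∑ i ∈ F.1, a i))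
    (hb : ∀ k, BddAbove (range fun F : smallFinsets S k => ∑ i ∈ F.1, b i))
    (hab : ∀ k, supSum (smallFinsets S k) a = supSum (smallFinsets S k) b)
    (hadd : ∀ k, supSum (smallFinsets S k) (a + b) = 2 * supSum (smallFinsets S k) a)
    {i : ι} (hi : i ∈ S) (hfin : {j ∈ S | (a + b) i ≤ (a + b) j}.Finite) : a i = b i := by
  classical
  set c := a + b
  have hfin' : {j ∈ S | c i < c j}.Finite := hfin.subset fun j hj => ⟨hj.1, hj.2.le⟩
  -- Both the strict superlevel set `G` and `insert i G` maximise sums of `c` among sets of no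
  -- larger cardinality. The sums of `a` and `b` agree over both, and subtraction isolates `i`.
  set G := hfin'.toFinset with hGdef
  have hmem : ∀ j, j ∈ G ↔ j ∈ S ∧ c i < c j := fun j => by simp [hGdef]
  have hci : 0 ≤ c i := add_nonneg (ha0 i) (hb0 i)
  have hiG : i ∉ G := fun h => lt_irrefl _ ((hmem i).1 h).2
  have h1 : ∑ j ∈ G, a j = ∑ j ∈ G, b j := by
    refine sum_eq_sum_of_supSum_eq (ha G.card) (hb G.card) (hab _) (hadd _)
      ⟨fun j hj => ((hmem j).1 hj).1, le_rfl⟩ fun F hF => ?_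
    refine sum_le_sum_of_superlevel hci (fun j hj => ((hmem j).1 hj).2.le) (fun j hj hjG => ?_) hF.2
    by_contra! h
    exact hjG ((hmem j).2 ⟨hF.1 hj, h⟩)
  have h2 : ∑ j ∈ insert i G, a j = ∑ j ∈ insert i G, b j := by
    refine sum_eq_sum_of_supSum_eq (ha (insert i G).card) (hb (insert i G).card) (hab _) (hadd _)
      ⟨fun j hj => ?_, le_rfl⟩ fun F hF => ?_
    · rcases Finset.mem_insert.1 hj with rfl | hj
      · exact hi
      · exact ((hmem j).1 hj).1
    · refine sum_le_sum_of_superlevel hci (fun j hj => ?_) (fun j hj hjG => ?_) hF.2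
      · rcases Finset.mem_insert.1 hj with rfl | hj
        · exact le_rfl
        · exact ((hmem j).1 hj).2.le
      · by_contra! h
        exact hjG (Finset.mem_insert_of_mem ((hmem j).2 ⟨hF.1 hj, h⟩))
  rw [Finset.sum_insert hiG, Finset.sum_insert hiG] at h2
  linarith

end TopSums

/-! ### Systems of open sets with a common root, and their products. -/

/-- A family of open sets, all of which contain the open set `root`, and any two of which meet only
inside `root`. -/
structure OpenSystem (K : Type*) [TopologicalSpace K] where
  /-- the common part -/
  root : Set K
  /-- the members -/
  sets : Set (Set K)
  isOpen_root : IsOpen root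
  isOpen_of_mem : ∀ W ∈ sets, IsOpen W
  root_subset : ∀ W ∈ sets, root ⊆ W
  inter_subset : ∀ W ∈ sets, ∀ V ∈ sets, W ≠ V → W ∩ V ⊆ root

namespace OpenSystem

variable {K : Type*} [TopologicalSpace K]

/-- The disjoint sets `W \ root`. -/
def atoms (S : OpenSystem K) : Set (Set K) :=
  (· \ S.root) '' S.sets

/-- The system whose only atom is the whole space. -/
def trivial (K : Type*) [TopologicalSpace K] : OpenSystem K where
  root := ∅
  sets := {univ}
  isOpen_root := isOpen_empty
  isOpen_of_mem := by simp
  root_subset := by simp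
  inter_subset := by
    rintro W rfl V rfl h
    exact absurd rfl h

/-- The system whose atoms are the intersections of an atom of `S` and an atom of `T`. -/
def prod (S T : OpenSystem K) : OpenSystem K where
  root := S.root ∩ ⋃₀ T.sets ∪ ⋃₀ S.sets ∩ T.root
  sets := image2 (fun W V => W ∩ V ∪ (S.root ∩ ⋃₀ T.sets ∪ ⋃₀ S.sets ∩ T.root)) S.sets T.sets
  isOpen_root := (S.isOpen_root.inter (isOpen_sUnion T.isOpen_of_mem)).union
    ((isOpen_sUnion S.isOpen_of_mem).inter T.isOpen_root)
  isOpen_of_mem := by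
    rintro _ ⟨W, hW, V, hV, rfl⟩
    exact ((S.isOpen_of_mem W hW).inter (T.isOpen_of_mem V hV)).union
      ((S.isOpen_root.inter (isOpen_sUnion T.isOpen_of_mem)).union
        ((isOpen_sUnion S.isOpen_of_mem).inter T.isOpen_root))
  root_subset := by
    rintro _ ⟨W, hW, V, hV, rfl⟩
    exact subset_union_right
  inter_subset := by
    rintro _ ⟨W, hW, V, hV, rfl⟩ _ ⟨W', hW', V', hV', rfl⟩ hne x ⟨hx, hx'⟩
    rcases hx with hx | hx
    swap
    · exact hx
    rcases hx' with hx' | hx'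
    swap
    · exact hx'
    by_cases hWW : W = W'
    · by_cases hVV : V = V'
      · subst hWW hVV
        exact absurd rfl hne
      · exact Or.inr ⟨⟨W, hW, hx.1⟩, T.inter_subset V hV V' hV' hVV ⟨hx.2, hx'.2⟩⟩
    · exact Or.inl ⟨S.inter_subset W hW W' hW' hWW ⟨hx.1, hx'.1⟩, ⟨V, hV, hx.2⟩⟩

/-- A point of `W ∩ V` already lies in both unions, so it avoids the product root exactly when it
avoids both roots. -/
theorem mem_atoms_prod {S T : OpenSystem K} {C : Set K} :
    C ∈ (S.prod T).atoms ↔ ∃ A ∈ S.atoms, ∃ B ∈ T.atoms, C = A ∩ B := by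
  have key : ∀ W ∈ S.sets, ∀ V ∈ T.sets,
      (W ∩ V ∪ (S.prod T).root) \ (S.prod T).root = (W \ S.root) ∩ (V \ T.root) := by
    intro W hW V hV
    ext x
    constructor
    · rintro ⟨⟨h1, h2⟩ | h, h3⟩
      · exact ⟨⟨h1, fun h => h3 (Or.inl ⟨h, V, hV, h2⟩)⟩,
          ⟨h2, fun h => h3 (Or.inr ⟨⟨W, hW, h1⟩, h⟩)⟩⟩
      · exact absurd h h3
    · rintro ⟨⟨h1, h2⟩, h3, h4⟩
      exact ⟨Or.inl ⟨h1, h3⟩, fun h => h.elim (fun h => h2 h.1) (fun h => h4 h.2)⟩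
  constructor
  · rintro ⟨_, ⟨W, hW, V, hV, rfl⟩, rfl⟩
    exact ⟨_, ⟨W, hW, rfl⟩, _, ⟨V, hV, rfl⟩, key W hW V hV⟩
  · rintro ⟨_, ⟨W, hW, rfl⟩, _, ⟨V, hV, rfl⟩, rfl⟩
    exact ⟨_, ⟨W, hW, V, hV, rfl⟩, key W hW V hV⟩

theorem inter_mem_atoms_prod {S T : OpenSystem K} {A B : Set K} (hA : A ∈ S.atoms)
    (hB : B ∈ T.atoms) : A ∩ B ∈ (S.prod T).atoms :=
  mem_atoms_prod.2 ⟨A, hA, B, hB, rfl⟩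

/-- The product of the systems `σ n`, for `n` in a list. -/
def listProd (σ : ℕ → OpenSystem K) : List ℕ → OpenSystem K
  | [] => trivial K
  | n :: l => (σ n).prod (listProd σ l)

theorem univ_mem_atoms_trivial : (univ : Set K) ∈ (trivial K).atoms :=
  ⟨univ, rfl, sdiff_empty⟩

end OpenSystem

/-! ### Atoms from Gruenhage families; measures determined by atoms. -/

theorem mem_iff_notMem_of_inter_pair_eq {α : Type*} {U : Set α} {x y z : α} (hxy : x ≠ y)
    (h : U ∩ {x, y} = {z}) : x ∈ U ↔ y ∉ U := by
  constructor
  · intro hx hy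
    have h1 : x ∈ ({z} : Set α) := h ▸ ⟨hx, by simp⟩
    have h2 : y ∈ ({z} : Set α) := h ▸ ⟨hy, by simp⟩
    exact hxy (h1.trans h2.symm)
  · intro hy
    have hz : z ∈ U ∩ {x, y} := h ▸ rfl
    rcases hz.2 with rfl | rfl
    · exact hz.1
    · exact absurd hz.1 hy

namespace OpenSystem

variable {K : Type*} [TopologicalSpace K]

theorem continuousOn_indicator_of_isClosed {A L : Set K} (h₁ : IsClosed (L ∩ A))
    (h₂ : IsClosed (L \ A)) : ContinuousOn (A.indicator (1 : K → ℝ)) L := by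
  have h : ContinuousOn (A.indicator (1 : K → ℝ)) (L ∩ A ∪ L \ A) := by
    refine ContinuousOn.union_of_isClosed ?_ ?_ h₁ h₂
    · exact (continuousOn_const (c := (1 : ℝ))).congr fun x hx => by simp [hx.2]
    · exact (continuousOn_const (c := (0 : ℝ))).congr fun x hx => by simp [hx.2]
  rwa [inter_union_sdiff] at h

/-- A Lusin-type statement: approximate each `A` and its complement from inside by compact sets,
with summable errors, and intersect. The indicators of all `A ∈ 𝒞` are then continuous on `L`. -/
theorem exists_isClosed_relatively_clopen [MeasurableSpace K] [BorelSpace K] [T2Space K]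
    {μ : Measure K} [IsFiniteMeasure μ] [μ.InnerRegularCompactLTTop]
    {𝒞 : Set (Set K)} (h𝒞 : 𝒞.Countable) (hmeas : ∀ A ∈ 𝒞, MeasurableSet A)
    {N : Set K} (hNm : MeasurableSet N) (hN : μ N = 0) {ε : ℝ≥0∞} (hε : 0 < ε) :
    ∃ L : Set K, IsClosed L ∧ Disjoint L N ∧
      (∀ A ∈ 𝒞, IsClosed (L ∩ A) ∧ IsClosed (L \ A)) ∧ μ Lᶜ ≤ ε := by
  have : Countable 𝒞 := h𝒞.to_subtype
  obtain ⟨δ, hδ0, hδ⟩ := ENNReal.exists_pos_sum_of_countable' (ENNReal.half_pos hε.ne').ne' 𝒞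
  have hdiff : ∀ A : 𝒞, ∃ C ⊆ A.1, ∃ D ⊆ A.1ᶜ, IsClosed C ∧ IsClosed D ∧ μ (C ∪ D)ᶜ ≤ δ A := by
    intro A
    obtain ⟨C, hCA, hC, hCε⟩ := (hmeas A A.2).exists_isCompact_sdiff_lt (measure_ne_top μ _)
      (ENNReal.half_pos (hδ0 A).ne').ne'
    obtain ⟨D, hDA, hD, hDε⟩ := (hmeas A A.2).compl.exists_isCompact_sdiff_lt (measure_ne_top μ _)
      (ENNReal.half_pos (hδ0 A).ne').ne'
    refine ⟨C, hCA, D, hDA, hC.isClosed, hD.isClosed, ?_⟩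
    calc μ (C ∪ D)ᶜ ≤ μ (A.1 \ C ∪ A.1ᶜ \ D) := measure_mono fun x hx => by
          by_cases hxA : x ∈ A.1
          · exact Or.inl ⟨hxA, fun h => hx (Or.inl h)⟩
          · exact Or.inr ⟨hxA, fun h => hx (Or.inr h)⟩
      _ ≤ δ A / 2 + δ A / 2 := (measure_union_le _ _).trans (add_le_add hCε.le hDε.le)
      _ = δ A := ENNReal.add_halves _
  choose C hCA D hDA hC hD hCD using hdiff
  obtain ⟨L₀, hL₀N, hL₀, hL₀ε⟩ := hNm.compl.exists_isCompact_sdiff_lt (measure_ne_top μ _)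
    (ENNReal.half_pos hε.ne').ne'
  have hLcl : IsClosed (L₀ ∩ ⋂ A : 𝒞, C A ∪ D A) :=
    hL₀.isClosed.inter (isClosed_iInter fun A => (hC A).union (hD A))
  refine ⟨L₀ ∩ ⋂ A : 𝒞, C A ∪ D A, hLcl,
    disjoint_left.2 fun x hx => hL₀N hx.1, fun A hA => ⟨?_, ?_⟩, ?_⟩
  · convert hLcl.inter (hC ⟨A, hA⟩) using 1
    ext x
    refine ⟨fun hx => ⟨hx.1, ?_⟩, fun hx => ⟨hx.1, hCA ⟨A, hA⟩ hx.2⟩⟩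
    exact (mem_iInter.1 hx.1.2 ⟨A, hA⟩).resolve_right fun h => hDA ⟨A, hA⟩ h hx.2
  · convert hLcl.inter (hD ⟨A, hA⟩) using 1
    ext x
    refine ⟨fun hx => ⟨hx.1, ?_⟩, fun hx => ⟨hx.1, hDA ⟨A, hA⟩ hx.2⟩⟩
    exact (mem_iInter.1 hx.1.2 ⟨A, hA⟩).resolve_left fun h => hx.2 (hCA ⟨A, hA⟩ h)
  · calc μ (L₀ ∩ ⋂ A : 𝒞, C A ∪ D A)ᶜ
        ≤ μ ((N ∪ Nᶜ \ L₀) ∪ ⋃ A : 𝒞, (C A ∪ D A)ᶜ) := measure_mono fun x hx => by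
          by_cases hx0 : x ∈ L₀
          · right
            by_contra h
            simp only [mem_iUnion, not_exists, Set.mem_compl_iff, not_not] at h
            exact hx ⟨hx0, mem_iInter.2 h⟩
          · left
            by_cases hxN : x ∈ N
            · exact Or.inl hxN
            · exact Or.inr ⟨hxN, hx0⟩
      _ ≤ (μ N + μ (Nᶜ \ L₀)) + μ (⋃ A : 𝒞, (C A ∪ D A)ᶜ) :=
          (measure_union_le _ _).trans (by gcongr; exact measure_union_le _ _)
      _ ≤ ε / 2 + ε / 2 := by
          rw [hN, zero_add]
          refine add_le_add hL₀ε.le ((measure_iUnion_le _).trans ?_)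
          exact (ENNReal.tsum_le_tsum hCD).trans hδ.le
      _ = ε := ENNReal.add_halves _

theorem inter_mem_atoms_listProd_append {σ : ℕ → OpenSystem K} (l : List ℕ) {l' : List ℕ}
    {A B : Set K} (hA : A ∈ (listProd σ l).atoms) (hB : B ∈ (listProd σ l').atoms) :
    A ∩ B ∈ (listProd σ (l ++ l')).atoms := by
  induction l generalizing A with
  | nil =>
    obtain ⟨W, rfl, rfl⟩ := hA
    simpa [listProd, trivial] using hB
  | cons n l ih =>
    obtain ⟨A₁, hA₁, A₂, hA₂, rfl⟩ := mem_atoms_prod.1 hA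
    rw [inter_assoc]
    exact inter_mem_atoms_prod hA₁ (ih hA₂)

/-- The points that lie in exactly `m` members of a family of open sets form a system, two points
being in the same atom if they lie in the same members. -/
def ofOpens (𝒰 : Set (Set K)) (h𝒰 : ∀ U ∈ 𝒰, IsOpen U) (m : ℕ) : OpenSystem K where
  root := ⋃₀ {W | ∃ F : Finset (Set K), (F : Set (Set K)) ⊆ 𝒰 ∧ F.card = m + 1 ∧ W = ⋂₀ F}
  sets := {W | ∃ F : Finset (Set K), (F : Set (Set K)) ⊆ 𝒰 ∧ F.card = m ∧
    W = ⋂₀ F ∪ ⋃₀ {W | ∃ F : Finset (Set K), (F : Set (Set K)) ⊆ 𝒰 ∧ F.card = m + 1 ∧ W = ⋂₀ F}}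
  isOpen_root := by
    refine isOpen_sUnion ?_
    rintro _ ⟨F, hF, -, rfl⟩
    exact F.finite_toSet.isOpen_sInter fun U hU => h𝒰 U (hF hU)
  isOpen_of_mem := by
    rintro _ ⟨F, hF, -, rfl⟩
    refine (F.finite_toSet.isOpen_sInter fun U hU => h𝒰 U (hF hU)).union (isOpen_sUnion ?_)
    rintro _ ⟨F, hF, -, rfl⟩
    exact F.finite_toSet.isOpen_sInter fun U hU => h𝒰 U (hF hU)
  root_subset := by
    rintro _ ⟨F, hF, -, rfl⟩
    exact subset_union_right
  inter_subset := by
    classical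
    rintro _ ⟨F, hF, hFm, rfl⟩ _ ⟨G, hG, hGm, rfl⟩ hne x ⟨hx, hx'⟩
    rcases hx with hx | hx
    swap
    · exact hx
    rcases hx' with hx' | hx'
    swap
    · exact hx'
    -- Two different families of size `m` have a union with at least `m + 1` members, so common
    -- points fall into the root.
    have hFG : ¬ G ⊆ F := fun h => by
      rw [Finset.eq_of_subset_of_card_le h (by omega)] at hne
      exact hne rfl
    obtain ⟨V, hVG, hVF⟩ := Finset.not_subset.1 hFG
    refine ⟨_, ⟨insert V F, ?_, ?_, rfl⟩, ?_⟩
    · rw [Finset.coe_insert]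
      exact insert_subset (hG hVG) hF
    · rw [Finset.card_insert_of_notMem hVF, hFm]
    · rw [Finset.coe_insert, sInter_insert]
      exact ⟨hx' V hVG, hx⟩

/-- Take for `m` the number of members containing `x`: a point of those `m` members that avoids the
root lies in no other member. -/
theorem exists_mem_atoms_ofOpens {𝒰 : Set (Set K)} (h𝒰 : ∀ U ∈ 𝒰, IsOpen U) {x : K}
    (hx : {V ∈ 𝒰 | x ∈ V}.Finite) :
    ∃ m, ∃ A ∈ (ofOpens 𝒰 h𝒰 m).atoms, x ∈ A ∧ ∀ y ∈ A, ∀ U ∈ 𝒰, x ∈ U ↔ y ∈ U := by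
  classical
  have hmem : ∀ V, V ∈ hx.toFinset ↔ V ∈ 𝒰 ∧ x ∈ V := fun V => by simp
  have hsub : (hx.toFinset : Set (Set K)) ⊆ 𝒰 := fun V hV => ((hmem V).1 hV).1
  refine ⟨hx.toFinset.card, _, ⟨_, ⟨hx.toFinset, hsub, rfl, rfl⟩, rfl⟩, ⟨Or.inl fun V hV =>
    ((hmem V).1 hV).2, ?_⟩, ?_⟩
  · rintro ⟨_, ⟨F, hF, hFc, rfl⟩, hxF⟩
    have := Finset.card_le_card (s := F) (t := hx.toFinset) fun V hV => (hmem V).2 ⟨hF hV, hxF V hV⟩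
    omega
  · rintro y ⟨hy, hyR⟩ U hU
    replace hy := hy.resolve_right hyR
    refine ⟨fun h => hy U ((hmem U).2 ⟨hU, h⟩), fun h => ?_⟩
    by_contra hxU
    refine hyR ⟨_, ⟨insert U hx.toFinset, ?_, ?_, rfl⟩, ?_⟩
    · rw [Finset.coe_insert]
      exact insert_subset hU hsub
    · exact Finset.card_insert_of_notMem fun h => hxU ((hmem U).1 h).2
    · rw [Finset.coe_insert, sInter_insert]
      exact ⟨h, hy⟩

theorem exists_separating_of_isGruenhageSpace (hK : IsGruenhageSpace K) :
    ∃ σ : ℕ → OpenSystem K, ∀ x y : K, x ≠ y →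
      ∃ n, ∃ A ∈ (σ n).atoms, (x ∈ A ∧ y ∉ A) ∨ (y ∈ A ∧ x ∉ A) := by
  obtain ⟨𝒰, h𝒰, hsep⟩ := hK
  refine ⟨fun n => ofOpens (𝒰 n.unpair.1) (h𝒰 _) n.unpair.2, fun x y hxy => ?_⟩
  obtain ⟨n, U, hU, ⟨z, hz⟩, hfin⟩ := hsep x y hxy
  have hiff := mem_iff_notMem_of_inter_pair_eq hxy hz
  rcases hfin with hfin | hfin
  all_goals
    obtain ⟨m, A, hA, hxA, hyA⟩ := exists_mem_atoms_ofOpens (h𝒰 n) hfin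
    refine ⟨Nat.pair n m, A, by simpa only [Nat.unpair_pair] using hA, ?_⟩
  · exact Or.inl ⟨hxA, fun h => by have := hyA y h U hU; tauto⟩
  · exact Or.inr ⟨hxA, fun h => by have := hyA x h U hU; tauto⟩

theorem pairwise_disjoint_diff_root (S : OpenSystem K) :
    Pairwise (Function.onFun Disjoint fun W : S.sets => W.1 \ S.root) := by
  intro W V hWV
  refine disjoint_left.2 fun x hx hx' => hx.2 ?_
  exact S.inter_subset W W.2 V V.2 (fun h => hWV (Subtype.ext h)) ⟨hx.1, hx'.1⟩

variable [MeasurableSpace K] [BorelSpace K]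

theorem measurableSet_of_mem_atoms {S : OpenSystem K} {A : Set K} (hA : A ∈ S.atoms) :
    MeasurableSet A := by
  obtain ⟨W, hW, rfl⟩ := hA
  exact (S.isOpen_of_mem W hW).measurableSet.diff S.isOpen_root.measurableSet

theorem countable_atoms_of_measure_ne_zero (S : OpenSystem K) (μ : Measure K) [IsFiniteMeasure μ] :
    {A ∈ S.atoms | μ A ≠ 0}.Countable := by
  have h := Measure.countable_meas_pos_of_disjoint_iUnion (μ := μ)
    (fun W : S.sets => measurableSet_of_mem_atoms ⟨W.1, W.2, rfl⟩) S.pairwise_disjoint_diff_root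
  refine (h.image fun W : S.sets => W.1 \ S.root).mono ?_
  rintro _ ⟨⟨W, hW, rfl⟩, hA⟩
  exact ⟨⟨W, hW⟩, pos_iff_ne_zero.2 hA, rfl⟩

/-- There may be uncountably many null atoms. But a compact subset of their union is covered by
relatively open null pieces `C ∩ W`, so it is null, and inner regularity finishes. -/
theorem measure_sUnion_null_atoms (S : OpenSystem K) (μ : Measure K) [IsFiniteMeasure μ]
    [μ.InnerRegularCompactLTTop] :
    MeasurableSet (⋃₀ {A ∈ S.atoms | μ A = 0}) ∧ μ (⋃₀ {A ∈ S.atoms | μ A = 0}) = 0 := by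
  have heq : ⋃₀ {A ∈ S.atoms | μ A = 0} = ⋃₀ {W ∈ S.sets | μ (W \ S.root) = 0} \ S.root := by
    ext x
    constructor
    · rintro ⟨_, ⟨⟨W, hW, rfl⟩, hA⟩, hx⟩
      exact ⟨⟨W, ⟨hW, hA⟩, hx.1⟩, hx.2⟩
    · rintro ⟨⟨W, ⟨hW, hA⟩, hx⟩, hxR⟩
      exact ⟨_, ⟨⟨W, hW, rfl⟩, hA⟩, hx, hxR⟩
  have hmeas : MeasurableSet (⋃₀ {A ∈ S.atoms | μ A = 0}) := by
    rw [heq]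
    exact (isOpen_sUnion fun W hW => S.isOpen_of_mem W hW.1).measurableSet.diff
      S.isOpen_root.measurableSet
  refine ⟨hmeas, ?_⟩
  rw [hmeas.measure_eq_iSup_isCompact_of_ne_top (measure_ne_top _ _)]
  simp only [ENNReal.iSup_eq_zero]
  intro C hCN hC
  rw [heq] at hCN
  refine hC.measure_zero_of_nhdsWithin fun x hx => ?_
  obtain ⟨⟨W, ⟨hW, hW0⟩, hxW⟩, -⟩ := hCN hx
  refine ⟨C ∩ W, inter_mem_nhdsWithin _ ((S.isOpen_of_mem W hW).mem_nhds hxW), ?_⟩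
  have hsub : C ∩ W ⊆ W \ S.root := fun y hy => ⟨hy.2, (hCN hy.1).2⟩
  exact measure_mono_null hsub hW0

/-- If `μ` and `ν` agree on the `σ`-algebra generated by a countable family `𝒞` that separates the
points off a null set, then `μ C ≤ ν C` for closed `C`. -/
theorem measure_le_of_countable_separating [CompactSpace K] [T2Space K] {μ ν : Measure K}
    [IsFiniteMeasure μ] [IsFiniteMeasure ν] [(μ + ν).InnerRegularCompactLTTop]
    {𝒞 : Set (Set K)} (h𝒞 : 𝒞.Countable) (hmeas : ∀ A ∈ 𝒞, MeasurableSet A)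
    (heq : ∀ s, MeasurableSet[MeasurableSpace.generateFrom 𝒞] s → μ s = ν s)
    {N : Set K} (hNm : MeasurableSet N) (hN : (μ + ν) N = 0)
    (hsep : ∀ x ∉ N, ∀ y ∉ N, (∀ A ∈ 𝒞, x ∈ A ↔ y ∈ A) → x = y)
    {C : Set K} (hC : IsClosed C) : μ C ≤ ν C := by
  classical
  have : Countable 𝒞 := h𝒞.to_subtype
  refine ENNReal.le_of_forall_pos_le_add fun ε hε _ => ?_
  obtain ⟨L, hL, hLN, hLc, hLε⟩ := exists_isClosed_relatively_clopen h𝒞 hmeas hNm hN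
    (ENNReal.half_pos (ENNReal.coe_pos.2 hε).ne')
  -- On `L` this map is continuous and injective. Hence `g '' (C ∩ L)` is compact, and its preimage
  -- belongs to the `σ`-algebra generated by `𝒞` and agrees with `C` on `L`.
  let g : K → 𝒞 → ℝ := fun x A => A.1.indicator 1 x
  have hgm : Measurable[MeasurableSpace.generateFrom 𝒞] g := by
    refine @measurable_pi_lambda _ _ _ (MeasurableSpace.generateFrom 𝒞) _ _ fun A => ?_
    exact (measurable_indicator_const_iff (m := MeasurableSpace.generateFrom 𝒞) (1 : ℝ)).2
      (MeasurableSpace.measurableSet_generateFrom A.2)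
  have hgc : ContinuousOn g L := by
    refine continuousOn_pi.2 fun A => continuousOn_indicator_of_isClosed (hLc A A.2).1 (hLc A A.2).2
  have hgC : MeasurableSet (g '' (C ∩ L)) :=
    ((hC.inter hL).isCompact.image_of_continuousOn (hgc.mono inter_subset_right)).measurableSet
  have hE := heq _ (hgm hgC)
  have hEL : g ⁻¹' (g '' (C ∩ L)) ∩ L ⊆ C := by
    rintro x ⟨⟨y, ⟨hyC, hyL⟩, hyx⟩, hxL⟩
    rwa [hsep x (disjoint_left.1 hLN hxL) y (disjoint_left.1 hLN hyL) fun A hA => ?_]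
    have := congrFun hyx ⟨A, hA⟩
    by_cases h1 : x ∈ A <;> by_cases h2 : y ∈ A <;> simp_all [g]
  have hμL : μ Lᶜ ≤ ε / 2 := (Measure.le_add_right le_rfl (Lᶜ)).trans hLε
  have hνL : ν Lᶜ ≤ ε / 2 := (Measure.le_add_left le_rfl (Lᶜ)).trans hLε
  calc μ C ≤ μ (g ⁻¹' (g '' (C ∩ L)) ∪ Lᶜ) := measure_mono fun x hx => by
        by_cases hxL : x ∈ L
        · exact Or.inl ⟨x, ⟨hx, hxL⟩, rfl⟩
        · exact Or.inr hxL
    _ ≤ μ (g ⁻¹' (g '' (C ∩ L))) + μ Lᶜ := measure_union_le _ _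
    _ ≤ ν (g ⁻¹' (g '' (C ∩ L))) + ε / 2 := by rw [hE]; gcongr
    _ ≤ ν (C ∪ Lᶜ) + ε / 2 := by
        gcongr
        intro x hx
        by_cases hxL : x ∈ L
        · exact Or.inl (hEL ⟨hx, hxL⟩)
        · exact Or.inr hxL
    _ ≤ ν C + ε / 2 + ε / 2 := by
        gcongr
        exact (measure_union_le _ _).trans (by gcongr)
    _ = ν C + ε := by rw [add_assoc, ENNReal.add_halves]

/-- Regular measures that agree on all finite intersections of atoms of the systems `σ n` are
equal, if the atoms separate points. -/
theorem measure_eq_of_atoms [CompactSpace K] [T2Space K] {μ ν : Measure K}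
    [IsFiniteMeasure μ] [IsFiniteMeasure ν] [(μ + ν).InnerRegularCompactLTTop]
    {σ : ℕ → OpenSystem K}
    (hσ : ∀ x y : K, x ≠ y → ∃ n, ∃ A ∈ (σ n).atoms, (x ∈ A ∧ y ∉ A) ∨ (y ∈ A ∧ x ∉ A))
    (h : ∀ l, ∀ A ∈ (listProd σ l).atoms, μ A = ν A) : μ = ν := by
  set 𝒞 : Set (Set K) := ⋃ n, {A ∈ (σ n).atoms | (μ + ν) A ≠ 0}
  have h𝒞 : 𝒞.Countable := countable_iUnion fun n => countable_atoms_of_measure_ne_zero _ _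
  have hmeas : ∀ A ∈ 𝒞, MeasurableSet A := fun A hA => by
    obtain ⟨n, hA⟩ := mem_iUnion.1 hA
    exact measurableSet_of_mem_atoms hA.1
  set N : Set K := ⋃ n, ⋃₀ {A ∈ (σ n).atoms | (μ + ν) A = 0}
  have hNm : MeasurableSet N := MeasurableSet.iUnion fun n => ((σ n).measure_sUnion_null_atoms _).1
  have hN : (μ + ν) N = 0 := measure_iUnion_null fun n => ((σ n).measure_sUnion_null_atoms _).2
  have hpi : ∀ s ∈ generatePiSystem 𝒞, ∃ l, s ∈ (listProd σ l).atoms := by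
    intro s hs
    induction hs with
    | base hs =>
      obtain ⟨n, hA⟩ := mem_iUnion.1 hs
      refine ⟨[n], ?_⟩
      simpa [listProd] using inter_mem_atoms_prod hA.1 univ_mem_atoms_trivial
    | inter _ _ _ ih₁ ih₂ =>
      obtain ⟨l₁, h₁⟩ := ih₁
      obtain ⟨l₂, h₂⟩ := ih₂
      exact ⟨_, inter_mem_atoms_listProd_append l₁ h₁ h₂⟩
  -- Finite intersections of sets in `𝒞` form a generating π-system; the empty list supplies
  -- equality of total masses.
  have heq : ∀ s, MeasurableSet[MeasurableSpace.generateFrom 𝒞] s → μ s = ν s := fun s hs =>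
    ext_on_measurableSpace_of_generate_finite _ (generatePiSystem 𝒞)
      (fun s hs => by obtain ⟨l, hl⟩ := hpi s hs; exact h l s hl)
      (MeasurableSpace.generateFrom_le hmeas) generateFrom_generatePiSystem_eq.symm
      (isPiSystem_generatePiSystem 𝒞) (h [] _ univ_mem_atoms_trivial) hs
  have hsep : ∀ x ∉ N, ∀ y ∉ N, (∀ A ∈ 𝒞, x ∈ A ↔ y ∈ A) → x = y := by
    intro x hx y hy hA
    by_contra hxy
    obtain ⟨n, A, hAn, hAxy⟩ := hσ x y hxy
    by_cases hA0 : (μ + ν) A = 0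
    · rcases hAxy with ⟨h, -⟩ | ⟨h, -⟩
      · exact hx (mem_iUnion.2 ⟨n, A, ⟨hAn, hA0⟩, h⟩)
      · exact hy (mem_iUnion.2 ⟨n, A, ⟨hAn, hA0⟩, h⟩)
    · have := hA A (mem_iUnion.2 ⟨n, hAn, hA0⟩)
      tauto
  have : (ν + μ).InnerRegularCompactLTTop := by rwa [add_comm]
  refine ext_of_generate_finite _ (BorelSpace.measurable_eq.trans borel_eq_generateFrom_isClosed)
    isPiSystem_isClosed (fun C hC => le_antisymm ?_ ?_) (heq _ MeasurableSet.univ)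
  · exact measure_le_of_countable_separating h𝒞 hmeas heq hNm hN hsep hC
  · exact measure_le_of_countable_separating h𝒞 hmeas (fun s hs => (heq s hs).symm) hNm
      (by rwa [add_comm]) hsep hC

end OpenSystem
-- Series and squares: semicontinuity and midpoint equality.
theorem lowerSemicontinuousOn_real_tsum {α ι : Type*} [TopologicalSpace α] {s : Set α}
    {f : ι → α → ℝ} (hf : ∀ i, LowerSemicontinuousOn (f i) s) (h0 : ∀ i, ∀ x ∈ s, 0 ≤ f i x)
    (hsum : ∀ x ∈ s, Summable fun i => f i x) :
    LowerSemicontinuousOn (fun x => ∑' i, f i x) s := by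
  intro x hx r hr
  obtain ⟨F, hF⟩ := ((hsum x hx).hasSum.eventually_const_lt hr).exists
  filter_upwards [lowerSemicontinuousOn_sum (a := F) (fun i _ => hf i) x hx r hF,
    self_mem_nhdsWithin] with y hy hys
  exact hy.trans_le ((hsum y hys).sum_le_tsum F fun i _ => h0 i y hys)

theorem lowerSemicontinuousOn_sq {α : Type*} [TopologicalSpace α] {s : Set α}
    {f : α → ℝ} (hf : LowerSemicontinuousOn f s) (h0 : ∀ x ∈ s, 0 ≤ f x) :
    LowerSemicontinuousOn (fun x => f x ^ 2) s := by
  intro x hx r hr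
  rcases lt_or_ge r 0 with hr0 | hr0
  · exact Eventually.of_forall fun y => hr0.trans_le (sq_nonneg _)
  have h : √r < f x := (Real.sqrt_lt' ((h0 x hx).lt_of_ne fun h => by
    simp [← h] at hr; exact absurd hr0 (not_le.2 hr))).2 hr
  filter_upwards [hf x hx _ h] with y hy
  exact (Real.sqrt_lt' ((Real.sqrt_nonneg r).trans_lt hy)).1 hy

theorem sq_midpoint_le {u v m : ℝ} (hm : 0 ≤ m) (h : m ≤ (u + v) / 2) :
    m ^ 2 ≤ (u ^ 2 + v ^ 2) / 2 := by
  nlinarith [sq_nonneg (u - v)]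

theorem eq_of_sq_midpoint_eq {u v m : ℝ} (hm : 0 ≤ m) (h : m ≤ (u + v) / 2)
    (heq : (u ^ 2 + v ^ 2) / 2 ≤ m ^ 2) : u = v ∧ m = u := by
  have huv : (u - v) ^ 2 ≤ 0 := by nlinarith
  have huv' : u = v := sub_eq_zero.1 (pow_eq_zero_iff two_ne_zero |>.1 (huv.antisymm (sq_nonneg _)))
  subst huv'
  refine ⟨rfl, ?_⟩
  nlinarith

theorem forall_le_of_tsum_le {ι : Type*} {f g : ι → ℝ} (hf : Summable f) (hg : Summable g)
    (hgf : ∀ i, g i ≤ f i) (h : ∑' i, f i ≤ ∑' i, g i) (i : ι) : f i ≤ g i := by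
  have hs : HasSum (fun i => f i - g i) (∑' i, f i - ∑' i, g i) := hf.hasSum.sub hg.hasSum
  have h0 : ∑' i, f i - ∑' i, g i = 0 :=
    le_antisymm (sub_nonpos.2 h) (sub_nonneg.2 (hg.tsum_le_tsum hgf hf))
  rw [h0, hasSum_zero_iff_of_nonneg fun i => sub_nonneg.2 (hgf i)] at hs
  exact sub_nonpos.1 (congrFun hs i).le

theorem coe_measureReal_add {α : Type*} [MeasurableSpace α] (μ ν : Measure α) [IsFiniteMeasure μ]
    [IsFiniteMeasure ν] : (μ + ν).real = μ.real + ν.real :=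
  funext fun _ => measureReal_add_apply

namespace OpenSystem

variable {K : Type*} [TopologicalSpace K] [MeasurableSpace K] [BorelSpace K]

/-- If an atom has positive mass, only finitely many disjoint atoms have at least that mass. As
every member contains the root, comparing members amounts to comparing atoms, so the top-sum lemma
applies. -/
theorem measure_atom_eq_of_supSum_eq (S : OpenSystem K) {μ ν : Measure K} [IsFiniteMeasure μ]
    [IsFiniteMeasure ν] (hroot : μ.real S.root = ν.real S.root)
    (hab : ∀ k, supSum (smallFinsets S.sets k) μ.real = supSum (smallFinsets S.sets k) ν.real)
    (hadd : ∀ k, supSum (smallFinsets S.sets k) (μ.real + ν.real) =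
      2 * supSum (smallFinsets S.sets k) μ.real) {A : Set K} (hA : A ∈ S.atoms) : μ A = ν A := by
  obtain ⟨W, hW, rfl⟩ := hA
  have hdiff : ∀ (ρ : Measure K) [IsFiniteMeasure ρ], ∀ V ∈ S.sets,
      ρ.real (V \ S.root) = ρ.real V - ρ.real S.root := fun ρ _ V hV =>
    measureReal_sdiff (S.root_subset V hV) S.isOpen_root.measurableSet
  rcases eq_or_ne ((μ + ν) (W \ S.root)) 0 with h0 | h0
  · rw [Measure.add_apply, add_eq_zero] at h0
    exact h0.1.trans h0.2.symm
  have hfin : {V ∈ S.sets | (μ.real + ν.real) W ≤ (μ.real + ν.real) V}.Finite := by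
    have h := Measure.finite_const_le_meas_of_disjoint_iUnion (μ + ν) (pos_iff_ne_zero.2 h0)
      (fun V : S.sets => measurableSet_of_mem_atoms ⟨V.1, V.2, rfl⟩) S.pairwise_disjoint_diff_root
      (measure_ne_top _ _)
    refine (h.image Subtype.val).subset ?_
    rintro V ⟨hV, hWV⟩
    refine ⟨⟨V, hV⟩, ?_, rfl⟩
    have h1 := hdiff (μ + ν) W hW
    have h2 := hdiff (μ + ν) V hV
    rw [← coe_measureReal_add] at hWV
    have h3 : (μ + ν).real (W \ S.root) ≤ (μ + ν).real (V \ S.root) := by linarith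
    exact (ENNReal.toReal_le_toReal (measure_ne_top _ _) (measure_ne_top _ _)).1 h3
  have hbdd : ∀ (ρ : Measure K) [IsFiniteMeasure ρ] (k : ℕ),
      BddAbove (range fun F : smallFinsets S.sets k => ∑ i ∈ F.1, ρ.real i) := fun ρ _ k =>
    bddAbove_range_sum (fun F hF => hF.2) measureReal_nonneg fun V => measureReal_mono (subset_univ V)
  have hWeq : μ.real W = ν.real W := eq_of_supSum_smallFinsets_eq (fun _ => measureReal_nonneg)
    (fun _ => measureReal_nonneg) (hbdd μ) (hbdd ν) hab hadd hW hfin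
  refine (ENNReal.toReal_eq_toReal_iff' (measure_ne_top _ _) (measure_ne_top _ _)).1 ?_
  change μ.real (W \ S.root) = ν.real (W \ S.root)
  rw [hdiff μ W hW, hdiff ν W hW, hWeq, hroot]

end OpenSystem

/-! ### Sublinear functionals on the cone and the strict energy. -/

section Functionals

variable {K : Type*} [TopologicalSpace K] [CompactSpace K]

/-- A nonnegative lower semicontinuous sublinear function on the cone of positive functionals,
dominated by the total mass. -/
structure IsSublinearOnCone (ψ : WeakDual ℝ C(K, ℝ) → ℝ) : Prop where
  lsc : LowerSemicontinuousOn ψ (positiveCone K)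
  nonneg : ∀ Λ ∈ positiveCone K, 0 ≤ ψ Λ
  le_mass : ∀ Λ ∈ positiveCone K, ψ Λ ≤ Λ 1
  add_le : ∀ Λ ∈ positiveCone K, ∀ Γ ∈ positiveCone K, ψ (Λ + Γ) ≤ ψ Λ + ψ Γ
  smul : ∀ Λ ∈ positiveCone K, ∀ c : ℝ, 0 ≤ c → ψ (c • Λ) = c * ψ Λ

variable [T2Space K] [MeasurableSpace K] [BorelSpace K]

theorem isSublinearOnCone_supSum {𝓕 : Set (Finset (Set K))} {k : ℕ} (hk : 0 < k)
    (hcard : ∀ F ∈ 𝓕, F.card ≤ k) (hopen : ∀ F ∈ 𝓕, ∀ U ∈ F, IsOpen U) :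
    IsSublinearOnCone fun Λ : WeakDual ℝ C(K, ℝ) => (k : ℝ)⁻¹ * supSum 𝓕 (reprMeasure Λ).real := by
  have hk' : (0 : ℝ) < k := Nat.cast_pos.2 hk
  have hbdd : ∀ Λ : WeakDual ℝ C(K, ℝ),
      BddAbove (range fun F : 𝓕 => ∑ U ∈ F.1, (reprMeasure Λ).real U) := fun Λ =>
    bddAbove_range_sum hcard measureReal_nonneg fun V => measureReal_mono (subset_univ V)
  constructor
  · have h : LowerSemicontinuousOn
        (fun Λ : WeakDual ℝ C(K, ℝ) => supSum 𝓕 (reprMeasure Λ).real) (positiveCone K) := by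
      refine lowerSemicontinuousOn_ciSup (fun Λ _ => hbdd Λ) fun F => ?_
      exact lowerSemicontinuousOn_sum fun U hU =>
        lowerSemicontinuousOn_reprMeasure_real (hopen F F.2 U hU)
    exact (continuous_const_mul ((k : ℝ)⁻¹)).comp_lowerSemicontinuousOn h
      fun x y hxy => mul_le_mul_of_nonneg_left hxy (inv_nonneg.2 hk'.le)
  · intro Λ _
    exact mul_nonneg (inv_nonneg.2 hk'.le) (supSum_nonneg _ fun _ => measureReal_nonneg)
  · intro Λ hΛ
    rw [inv_mul_le_iff₀ hk', ← reprMeasure_real_univ hΛ]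
    exact supSum_le hcard measureReal_nonneg fun V => measureReal_mono (subset_univ V)
  · intro Λ hΛ Γ hΓ
    rw [← mul_add, reprMeasure_add hΛ hΓ, coe_measureReal_add]
    exact mul_le_mul_of_nonneg_left (supSum_add_le (fun _ => measureReal_nonneg)
      (fun _ => measureReal_nonneg) (hbdd Λ) (hbdd Γ)) (inv_nonneg.2 hk'.le)
  · intro Λ hΛ c hc
    rw [reprMeasure_smul hΛ hc, mul_left_comm, ← supSum_smul _ _ hc]
    congr 2
    ext U
    simp [measureReal_def, ENNReal.toReal_ofReal hc]

theorem exists_sublinear_separating (hK : IsGruenhageSpace K) :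
    ∃ ψ : ℕ → WeakDual ℝ C(K, ℝ) → ℝ, (∀ j, IsSublinearOnCone (ψ j)) ∧
      ∀ Λ ∈ positiveCone K, ∀ Γ ∈ positiveCone K, (∀ j, ψ j Λ = ψ j Γ) →
        (∀ j, ψ j (Λ + Γ) = 2 * ψ j Λ) → Λ = Γ := by
  obtain ⟨σ, hσ⟩ := OpenSystem.exists_separating_of_isGruenhageSpace hK
  obtain ⟨e, he⟩ := exists_surjective_nat (List ℕ × Option ℕ)
  -- `none` selects the root and `some k` the sums over at most `k` members; the bound `k + 1` in
  -- `b` keeps the normalising factor nonzero at `k = 0`.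
  let 𝓕 : List ℕ × Option ℕ → Set (Finset (Set K)) := fun i =>
    i.2.elim {{(OpenSystem.listProd σ i.1).root}} fun k =>
      smallFinsets (OpenSystem.listProd σ i.1).sets k
  let b : List ℕ × Option ℕ → ℕ := fun i => i.2.elim 1 fun k => k + 1
  have hb : ∀ i, 0 < b i := by
    rintro ⟨l, _ | k⟩
    · exact one_pos
    · exact Nat.succ_pos k
  have hψ : ∀ i, IsSublinearOnCone fun Λ : WeakDual ℝ C(K, ℝ) =>
      (b i : ℝ)⁻¹ * supSum (𝓕 i) (reprMeasure Λ).real := by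
    rintro ⟨l, _ | k⟩
    · refine isSublinearOnCone_supSum (hb _) ?_ ?_
      · rintro F rfl
        simp [b]
      · rintro F rfl U hU
        rw [Finset.mem_singleton.1 hU]
        exact OpenSystem.isOpen_root _
    · exact isSublinearOnCone_supSum (hb _) (fun F hF => hF.2.trans (Nat.le_succ k))
        fun F hF U hU => OpenSystem.isOpen_of_mem _ U (hF.1 hU)
  refine ⟨fun j Λ => (b (e j) : ℝ)⁻¹ * supSum (𝓕 (e j)) (reprMeasure Λ).real,
    fun j => hψ (e j), fun Λ hΛ Γ hΓ heq hadd => ?_⟩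
  have hb' : ∀ i, ((b i : ℝ)⁻¹) ≠ 0 := fun i => inv_ne_zero (Nat.cast_ne_zero.2 (hb i).ne')
  have heq' : ∀ i, supSum (𝓕 i) (reprMeasure Λ).real = supSum (𝓕 i) (reprMeasure Γ).real := by
    intro i
    obtain ⟨j, rfl⟩ := he i
    exact mul_left_cancel₀ (hb' _) (heq j)
  have hsum : (reprMeasure (Λ + Γ)).real = (reprMeasure Λ).real + (reprMeasure Γ).real := by
    rw [reprMeasure_add hΛ hΓ, coe_measureReal_add]
  have hadd' : ∀ i, supSum (𝓕 i) ((reprMeasure Λ).real + (reprMeasure Γ).real) =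
      2 * supSum (𝓕 i) (reprMeasure Λ).real := by
    intro i
    obtain ⟨j, rfl⟩ := he i
    have := hadd j
    rw [mul_left_comm] at this
    simp only [hsum] at this
    exact mul_left_cancel₀ (hb' _) this
  refine eq_of_reprMeasure_eq hΛ hΓ (OpenSystem.measure_eq_of_atoms hσ fun l A hA => ?_)
  refine OpenSystem.measure_atom_eq_of_supSum_eq (OpenSystem.listProd σ l) ?_ (fun k => heq' (l, some k))
    (fun k => hadd' (l, some k)) hA
  simpa [𝓕, supSum] using heq' (l, none)

end Functionals

/-- A nonnegative, lower semicontinuous, convex and quadratically homogeneous function on the cone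
of positive functionals that dominates the squared mass and is strictly convex at midpoints. -/
structure IsStrictEnergy {K : Type*} [TopologicalSpace K] [CompactSpace K]
    (Φ : WeakDual ℝ C(K, ℝ) → ℝ) : Prop where
  lsc : LowerSemicontinuousOn Φ (positiveCone K)
  convex : ConvexOn ℝ (positiveCone K) Φ
  smul : ∀ Λ ∈ positiveCone K, ∀ c : ℝ, 0 ≤ c → Φ (c • Λ) = c ^ 2 * Φ Λ
  sq_mass_le : ∀ Λ ∈ positiveCone K, (Λ 1) ^ 2 ≤ Φ Λ
  strict : ∀ Λ ∈ positiveCone K, ∀ Γ ∈ positiveCone K,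
    (Φ Λ + Φ Γ) / 2 ≤ Φ ((1 / 2 : ℝ) • Λ + (1 / 2 : ℝ) • Γ) → Λ = Γ

theorem exists_isStrictEnergy {K : Type*} [TopologicalSpace K] [CompactSpace K] [T2Space K]
    (hK : IsGruenhageSpace K) : ∃ Φ : WeakDual ℝ C(K, ℝ) → ℝ, IsStrictEnergy Φ := by
  borelize K
  obtain ⟨ψ, hψ, hsep⟩ := exists_sublinear_separating hK
  have hsum : ∀ Λ ∈ positiveCone K, Summable fun j => (1 / 2 : ℝ) ^ j * ψ j Λ ^ 2 := fun Λ hΛ => by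
    refine Summable.of_nonneg_of_le (fun j => by positivity) (fun j => ?_)
      (summable_geometric_two.mul_right (Λ 1 ^ 2))
    have := (hψ j).nonneg Λ hΛ
    have := (hψ j).le_mass Λ hΛ
    gcongr
  have hconv : ∀ j, ConvexOn ℝ (positiveCone K) fun Λ => (1 / 2 : ℝ) ^ j * ψ j Λ ^ 2 := fun j => by
    have h : ConvexOn ℝ (positiveCone K) (ψ j) := by
      refine ⟨convex_positiveCone, fun Λ hΛ Γ hΓ a b ha hb _ => ?_⟩
      rw [smul_eq_mul, smul_eq_mul, ← (hψ j).smul Λ hΛ a ha, ← (hψ j).smul Γ hΓ b hb]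
      exact (hψ j).add_le _ (smul_mem_positiveCone hΛ ha) _ (smul_mem_positiveCone hΓ hb)
    exact (h.pow (hψ j).nonneg 2).smul (by positivity)
  have hmass : ConvexOn ℝ (positiveCone K) fun Λ : WeakDual ℝ C(K, ℝ) => (Λ 1) ^ 2 := by
    have h : ConvexOn ℝ (positiveCone K) fun Λ : WeakDual ℝ C(K, ℝ) => Λ 1 :=
      ⟨convex_positiveCone, fun Λ _ Γ _ a b _ _ _ => le_rfl⟩
    exact h.pow (fun Λ hΛ => hΛ 1 zero_le_one) 2
  have hmid : ∀ Λ ∈ positiveCone K, ∀ Γ ∈ positiveCone K,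
      (1 / 2 : ℝ) • Λ + (1 / 2 : ℝ) • Γ ∈ positiveCone K := fun Λ hΛ Γ hΓ =>
    convex_positiveCone hΛ hΓ (by norm_num) (by norm_num) (by norm_num)
  refine ⟨fun Λ => (Λ 1) ^ 2 + ∑' j, (1 / 2 : ℝ) ^ j * ψ j Λ ^ 2, ⟨?_, ?_, ?_, ?_, ?_⟩⟩
  · refine LowerSemicontinuousOn.add
      (((WeakDual.eval_continuous 1).pow 2).lowerSemicontinuous.lowerSemicontinuousOn _)
      (lowerSemicontinuousOn_real_tsum (fun j => ?_) (fun j Λ _ => by positivity) hsum)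
    exact (continuous_const_mul ((1 / 2 : ℝ) ^ j)).comp_lowerSemicontinuousOn
      (lowerSemicontinuousOn_sq (hψ j).lsc (hψ j).nonneg)
      fun x y hxy => mul_le_mul_of_nonneg_left hxy (by positivity)
  · refine hmass.add ⟨convex_positiveCone, fun Λ hΛ Γ hΓ a b ha hb hab => ?_⟩
    rw [smul_eq_mul, smul_eq_mul, ← tsum_mul_left, ← tsum_mul_left,
      ← ((hsum Λ hΛ).mul_left a).tsum_add ((hsum Γ hΓ).mul_left b)]
    exact (hsum _ (convex_positiveCone hΛ hΓ ha hb hab)).tsum_le_tsum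
      (fun j => (hconv j).2 hΛ hΓ ha hb hab) (((hsum Λ hΛ).mul_left a).add ((hsum Γ hΓ).mul_left b))
  · intro Λ hΛ c hc
    have h1 : (c • Λ) 1 = c * Λ 1 := rfl
    rw [mul_add, ← tsum_mul_left, h1, mul_pow]
    congr 2
    ext j
    rw [(hψ j).smul Λ hΛ c hc]
    ring
  · intro Λ _
    exact le_add_of_nonneg_right (tsum_nonneg fun j => by positivity)
  · intro Λ hΛ Γ hΓ h
    have h1 := hmass.2 hΛ hΓ (by norm_num : (0 : ℝ) ≤ 1 / 2) (by norm_num : (0 : ℝ) ≤ 1 / 2)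
      (by norm_num)
    have hle : ∀ j, ψ j ((1 / 2 : ℝ) • Λ + (1 / 2 : ℝ) • Γ) ≤ (ψ j Λ + ψ j Γ) / 2 := fun j => by
      have := (hψ j).add_le _ (smul_mem_positiveCone hΛ (c := 1 / 2) (by norm_num)) _
        (smul_mem_positiveCone hΓ (c := 1 / 2) (by norm_num))
      rw [(hψ j).smul Λ hΛ _ (by norm_num), (hψ j).smul Γ hΓ _ (by norm_num)] at this
      linarith
    -- The mass term is convex, so it cannot compensate a loss in the series; equality must hold in
    -- each term.
    have h2 := forall_le_of_tsum_le (((hsum Λ hΛ).add (hsum Γ hΓ)).div_const 2)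
      (hsum _ (hmid Λ hΛ Γ hΓ)) (fun j => by
        have := sq_midpoint_le ((hψ j).nonneg _ (hmid Λ hΛ Γ hΓ)) (hle j)
        calc _ ≤ (1 / 2 : ℝ) ^ j * ((ψ j Λ ^ 2 + ψ j Γ ^ 2) / 2) := by gcongr
          _ = _ := by ring) (by
        rw [tsum_div_const, (hsum Λ hΛ).tsum_add (hsum Γ hΓ)]
        simp only [smul_eq_mul] at h1
        linarith)
    have h3 : ∀ j, ψ j Λ = ψ j Γ ∧ ψ j ((1 / 2 : ℝ) • Λ + (1 / 2 : ℝ) • Γ) = ψ j Λ := fun j => by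
      refine eq_of_sq_midpoint_eq ((hψ j).nonneg _ (hmid Λ hΛ Γ hΓ)) (hle j) ?_
      refine le_of_mul_le_mul_left (a := (1 / 2 : ℝ) ^ j) ?_ (by positivity)
      calc _ = _ := by ring
        _ ≤ _ := h2 j
    refine hsep Λ hΛ Γ hΓ (fun j => (h3 j).1) fun j => ?_
    rw [← (h3 j).2, ← (hψ j).smul _ (hmid Λ hΛ Γ hΓ) 2 zero_le_two]
    congr 1
    rw [← smul_add, smul_smul]
    norm_num

/-! ### Seminorms from quadratic functions, and dual norms. -/

theorem exists_seminorm_eq_sqrt {E : Type*} [AddCommGroup E] [Module ℝ E] {Q : E → ℝ}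
    (hconv : ConvexOn ℝ univ Q) (hsmul : ∀ (c : ℝ) x, Q (c • x) = c ^ 2 * Q x) :
    ∃ D : Seminorm ℝ E, ∀ x, D x = √(Q x) := by
  have hadd : ∀ x y, √(Q (x + y)) ≤ √(Q x) + √(Q y) := by
    intro x y
    refine le_of_forall_pos_le_add fun δ hδ => ?_
    -- As for a gauge, subadditivity follows from convexity of `{Q ≤ 1}`; the margin `δ / 2` keeps
    -- the scaling factors positive where `Q` vanishes.
    have key : ∀ x, 0 < √(Q x) + δ / 2 ∧ Q ((√(Q x) + δ / 2)⁻¹ • x) ≤ 1 := by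
      intro x
      have ha : 0 < √(Q x) + δ / 2 := by positivity
      refine ⟨ha, ?_⟩
      rw [hsmul, inv_pow, inv_mul_le_iff₀ (by positivity), mul_one]
      rcases le_or_gt 0 (Q x) with h | h
      · nlinarith [Real.sq_sqrt h, Real.sqrt_nonneg (Q x)]
      · exact h.le.trans (sq_nonneg _)
    obtain ⟨ha, hx⟩ := key x
    obtain ⟨hb, hy⟩ := key y
    set a := √(Q x) + δ / 2
    set b := √(Q y) + δ / 2
    have hxy : x + y = (a + b) • ((a / (a + b)) • a⁻¹ • x + (b / (a + b)) • b⁻¹ • y) := by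
      simp only [smul_add, smul_smul]
      congr 1
      · rw [show (a + b) * (a / (a + b) * a⁻¹) = 1 by field_simp, one_smul]
      · rw [show (a + b) * (b / (a + b) * b⁻¹) = 1 by field_simp, one_smul]
    have h1 := hconv.2 (mem_univ (a⁻¹ • x)) (mem_univ (b⁻¹ • y))
      (by positivity : 0 ≤ a / (a + b)) (by positivity : 0 ≤ b / (a + b)) (by field_simp)
    have h2 : Q ((a / (a + b)) • a⁻¹ • x + (b / (a + b)) • b⁻¹ • y) ≤ 1 := by
      refine h1.trans ?_
      calc _ ≤ a / (a + b) * 1 + b / (a + b) * 1 := by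
            simp only [smul_eq_mul]
            gcongr
        _ = 1 := by field_simp
    calc √(Q (x + y)) ≤ √((a + b) ^ 2) := by
          refine Real.sqrt_le_sqrt ?_
          rw [hxy, hsmul]
          exact mul_le_of_le_one_right (sq_nonneg _) h2
      _ = a + b := Real.sqrt_sq (by positivity)
      _ = √(Q x) + √(Q y) + δ := by simp only [a, b]; ring
  refine ⟨Seminorm.of (fun x => √(Q x)) hadd fun c x => ?_, fun x => rfl⟩
  rw [hsmul, Real.sqrt_mul (sq_nonneg c), Real.sqrt_sq_eq_abs, Real.norm_eq_abs]

section DualNorm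

variable {X : Type*} [NormedAddCommGroup X] [NormedSpace ℝ X]

theorem exists_eval_separating {B : Set (WeakDual ℝ X)} (hB : Convex ℝ B) (hBc : IsClosed B)
    {g : WeakDual ℝ X} (hg : g ∉ B) : ∃ (x : X) (u : ℝ), (∀ h ∈ B, h x < u) ∧ u < g x := by
  have : LocallyConvexSpace ℝ (WeakDual ℝ X) :=
    inferInstanceAs (LocallyConvexSpace ℝ (WeakBilin (topDualPairing ℝ X)))
  obtain ⟨φ, u, hφ, hu⟩ := geometric_hahn_banach_closed_point hB hBc hg
  obtain ⟨x, rfl⟩ := LinearMap.dualEmbedding_surjective (topDualPairing ℝ X) φ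
  exact ⟨x, u, hφ, hu⟩

/-- A `w*`-lower semicontinuous norm on the dual that is equivalent to the canonical norm is an
equivalent dual norm. -/
theorem isEquivalentDualNorm_of_isWeakStarLSC {D : Seminorm ℝ (StrongDual ℝ X)}
    (hD : AreEquivalent D (normSeminorm ℝ (StrongDual ℝ X))) (hlsc : IsWeakStarLSC D) :
    IsEquivalentDualNorm D := by
  refine ⟨hD, ?_⟩
  obtain ⟨⟨C, hC, hDC⟩, ⟨c, hc, hDc⟩⟩ := hD
  simp only [coe_normSeminorm] at hDC hDc
  have hle : ∀ (f : StrongDual ℝ X), D f ≤ 1 → ∀ x, |f x| ≤ c * ‖x‖ := fun f hf x =>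
    (f.le_opNorm x).trans (mul_le_mul_of_nonneg_right
      ((hDc f).trans (mul_le_of_le_one_right hc.le hf)) (norm_nonneg x))
  -- The predual norm is the supremum of `|f x|` over the unit ball of `D`.
  let s : {f : StrongDual ℝ X // D f ≤ 1} → Seminorm ℝ X := fun f =>
    (f.1 : X →ₗ[ℝ] ℝ).toSeminorm
  have hs : ∀ f x, s f x = |f.1 x| := fun f x => rfl
  have hbdd : ∀ x, BddAbove (range fun f => s f x) := fun x => by
    refine ⟨c * ‖x‖, ?_⟩
    rintro _ ⟨f, rfl⟩
    exact hle f.1 f.2 x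
  have hN : ∀ x, (⨆ f, s f) x = ⨆ f, s f x := fun x =>
    Seminorm.iSup_apply (Seminorm.bddAbove_range_iff.2 hbdd)
  have hNle : ∀ (f : StrongDual ℝ X), D f ≤ 1 → ∀ x, |f x| ≤ (⨆ f, s f) x := fun f hf x => by
    rw [hN]
    exact le_ciSup (hbdd x) ⟨f, hf⟩
  have : Nonempty {f : StrongDual ℝ X // D f ≤ 1} := ⟨⟨0, by simp⟩⟩
  refine ⟨⨆ f, s f, ⟨⟨c, hc, fun x => ?_⟩, ⟨C, hC, fun x => ?_⟩⟩, fun f => ⟨?_, ?_⟩⟩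
  · rw [hN]
    exact ciSup_le fun f => hle f.1 f.2 x
  · obtain ⟨f, hf1, hfx⟩ := exists_dual_vector'' ℝ x
    have h := hNle (C⁻¹ • f) (by
      rw [map_smul_eq_mul, Real.norm_of_nonneg (inv_nonneg.2 hC.le), inv_mul_le_iff₀ hC, mul_one]
      exact (hDC f).trans (mul_le_of_le_one_right hC.le hf1)) x
    have hfx' : (C⁻¹ • f) x = C⁻¹ * ‖x‖ := by simp [hfx]
    rw [hfx', abs_of_nonneg (by positivity), inv_mul_le_iff₀ hC] at h
    exact h
  · rintro _ ⟨x, hx, rfl⟩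
    rcases eq_or_ne (D f) 0 with h0 | h0
    · have : f = 0 := by
        have := hDc f
        rw [h0, mul_zero] at this
        exact norm_le_zero_iff.1 this
      simp [this]
    · have hpos : 0 < D f := (apply_nonneg D f).lt_of_ne' h0
      have h := hNle ((D f)⁻¹ • f) (by
        rw [map_smul_eq_mul, Real.norm_of_nonneg (inv_nonneg.2 hpos.le), inv_mul_cancel₀ h0]) x
      have h' := (le_abs_self _).trans (h.trans hx)
      rw [smul_apply, smul_eq_mul, inv_mul_le_iff₀ hpos, mul_one] at h'
      exact h'
  · intro b hb
    by_contra! hbD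
    have hb0 : 0 ≤ b := hb ⟨0, by simp, by simp⟩
    -- The bipolar argument: `r⁻¹ • f` lies outside the `w*`-closed unit ball of `D`, and a
    -- separating `x`, rescaled to `N ≤ 1`, gives `f` a value above `b`.
    obtain ⟨r, hbr, hrD⟩ := exists_between hbD
    have hr : 0 < r := hb0.trans_lt hbr
    have hBc : IsClosed {h : WeakDual ℝ X | D (WeakDual.toStrongDual h) ≤ 1} :=
      LowerSemicontinuous.isClosed_preimage hlsc 1
    have hB : Convex ℝ {h : WeakDual ℝ X | D (WeakDual.toStrongDual h) ≤ 1} := by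
      have := (D.convexOn.convex_le 1).is_linear_preimage
        (f := (WeakDual.toStrongDual : WeakDual ℝ X ≃ₗ[ℝ] _)) ⟨map_add _, map_smul _⟩
      simpa using this
    obtain ⟨x, u, hxu, hux⟩ := exists_eval_separating hB hBc
      (g := StrongDual.toWeakDual (r⁻¹ • f)) (by
        simp only [mem_ofPred_eq, not_le, StrongDual.toStrongDual_toWeakDual]
        rw [map_smul_eq_mul, Real.norm_of_nonneg (inv_nonneg.2 hr.le), lt_inv_mul_iff₀ hr, mul_one]
        exact hrD)
    have hu : 0 < u := hxu 0 (by simp)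
    have hNx : (⨆ f, s f) (u⁻¹ • x) ≤ 1 := by
      rw [hN]
      refine ciSup_le fun h => ?_
      have h1 := hxu (StrongDual.toWeakDual h.1) h.2
      have h2 := hxu (StrongDual.toWeakDual (-h.1)) (by simpa using h.2)
      have h1' : h.1 x < u := h1
      have h2' : -(h.1 x) < u := h2
      rw [hs, map_smul, smul_eq_mul, abs_mul, abs_of_pos (inv_pos.2 hu), inv_mul_le_iff₀ hu,
        mul_one, abs_le]
      constructor <;> linarith
    have h3 := hb ⟨u⁻¹ • x, hNx, rfl⟩
    have h4 : u < r⁻¹ * f x := hux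
    rw [map_smul, smul_eq_mul, inv_mul_le_iff₀ hu] at h3
    rw [lt_inv_mul_iff₀ hr] at h4
    nlinarith

theorem isWeakStarLSC_norm : IsWeakStarLSC (normSeminorm ℝ (StrongDual ℝ X)) := by
  refine lowerSemicontinuous_iff_isClosed_preimage.2 fun r => ?_
  convert WeakDual.isClosed_closedBall (𝕜 := ℝ) (0 : StrongDual ℝ X) r using 1
  ext f
  simp

end DualNorm

/-! ### Inf-convolution with a strictly convex penalty. -/

section InfConvolution

variable {E F : Type*} [AddCommGroup E] [Module ℝ E] [TopologicalSpace E]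
  [AddCommGroup F] [Module ℝ F]

/-- A quadratically homogeneous, lower semicontinuous function on a convex cone `Z`, with compact
sublevel sets, that is strictly convex at midpoints. -/
structure IsPenalty (Z : Set E) (Ψ : E → ℝ) : Prop where
  zero_mem : 0 ∈ Z
  smul_mem : ∀ z ∈ Z, ∀ c : ℝ, 0 ≤ c → c • z ∈ Z
  lsc : LowerSemicontinuousOn Ψ Z
  convex : ConvexOn ℝ Z Ψ
  nonneg : ∀ z ∈ Z, 0 ≤ Ψ z
  smul : ∀ z ∈ Z, ∀ c : ℝ, 0 ≤ c → Ψ (c • z) = c ^ 2 * Ψ z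
  isCompact_sublevel : ∀ c, IsCompact {z ∈ Z | Ψ z ≤ c}
  strict : ∀ z ∈ Z, ∀ w ∈ Z, (Ψ z + Ψ w) / 2 ≤ Ψ ((1 / 2 : ℝ) • z + (1 / 2 : ℝ) • w) → z = w

theorem IsPenalty.map_zero {Z : Set E} {Ψ : E → ℝ} (h : IsPenalty Z Ψ) : Ψ 0 = 0 := by
  simpa using h.smul 0 h.zero_mem 0 le_rfl

/-- The function `f ↦ inf {p (f - τ z) ^ 2 + ε * Ψ z | z ∈ Z}`. -/
noncomputable def infConv (p : Seminorm ℝ F) (τ : E →ₗ[ℝ] F) (Z : Set E) (Ψ : E → ℝ) (ε : ℝ)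
    (f : F) : ℝ :=
  ⨅ z : Z, (p (f - τ z) ^ 2 + ε * Ψ z)

variable {p : Seminorm ℝ F} {τ : E →ₗ[ℝ] F} {Z : Set E} {Ψ : E → ℝ} {ε : ℝ}

namespace IsPenalty

theorem infConv_le (h : IsPenalty Z Ψ) (hε : 0 < ε) (f : F) {z : E} (hz : z ∈ Z) :
    infConv p τ Z Ψ ε f ≤ p (f - τ z) ^ 2 + ε * Ψ z := by
  refine ciInf_le (f := fun z : Z => p (f - τ z) ^ 2 + ε * Ψ z) ⟨0, ?_⟩ ⟨z, hz⟩
  rintro _ ⟨w, rfl⟩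
  have := h.nonneg w w.2
  positivity

theorem infConv_nonneg (h : IsPenalty Z Ψ) (hε : 0 < ε) (f : F) : 0 ≤ infConv p τ Z Ψ ε f :=
  Real.iInf_nonneg fun w => by
    have := h.nonneg w w.2
    positivity

theorem infConv_le_sq (h : IsPenalty Z Ψ) (hε : 0 < ε) (f : F) :
    infConv p τ Z Ψ ε f ≤ p f ^ 2 := by
  simpa [h.map_zero] using h.infConv_le (p := p) (τ := τ) hε f h.zero_mem

theorem tendsto_infConv (h : IsPenalty Z Ψ) {f : F}
    (hf : ∀ δ > 0, ∃ z ∈ Z, p (f - τ z) < δ) :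
    Tendsto (fun n : ℕ => infConv p τ Z Ψ (1 / ((n : ℝ) + 1)) f) atTop (𝓝 0) := by
  refine tendsto_order.2 ⟨fun a ha => Eventually.of_forall fun n =>
    ha.trans_le (h.infConv_nonneg (by positivity) f), fun a ha => ?_⟩
  obtain ⟨z, hz, hfz⟩ := hf (√a) (Real.sqrt_pos.2 ha)
  have hfz' : p (f - τ z) ^ 2 < a := by
    have := (sq_lt_sq₀ (apply_nonneg p _) (Real.sqrt_nonneg a)).2 hfz
    rwa [Real.sq_sqrt ha.le] at this
  have hlim : Tendsto (fun n : ℕ => p (f - τ z) ^ 2 + 1 / ((n : ℝ) + 1) * Ψ z) atTop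
      (𝓝 (p (f - τ z) ^ 2 + 0 * Ψ z)) :=
    tendsto_const_nhds.add (tendsto_one_div_add_atTop_nhds_zero_nat.mul_const _)
  rw [zero_mul, add_zero] at hlim
  filter_upwards [hlim.eventually_lt_const hfz'] with n hn
  exact (h.infConv_le (by positivity) f hz).trans_lt hn

variable [TopologicalSpace F]

/-- Where `Ψ z > p f ^ 2 / ε` the objective exceeds its value at `z = 0`, so only a compact sublevel
set competes. -/
theorem exists_infConv_eq [IsTopologicalAddGroup F] (h : IsPenalty Z Ψ) (hε : 0 < ε)
    (hp : LowerSemicontinuous p) (hτ : Continuous τ) (f : F) :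
    ∃ z ∈ Z, p (f - τ z) ^ 2 + ε * Ψ z = infConv p τ Z Ψ ε f := by
  set S := {z ∈ Z | Ψ z ≤ p f ^ 2 / ε}
  have h0S : (0 : E) ∈ S := ⟨h.zero_mem, by rw [h.map_zero]; positivity⟩
  have hlsc : LowerSemicontinuousOn (fun z => p (f - τ z) ^ 2 + ε * Ψ z) S := by
    refine LowerSemicontinuousOn.add ?_ ?_
    · exact lowerSemicontinuousOn_sq
        ((hp.comp (continuous_const.sub hτ)).lowerSemicontinuousOn _) fun _ _ => apply_nonneg _ _
    · exact (continuous_const_mul ε).comp_lowerSemicontinuousOn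
        (h.lsc.mono fun z hz => hz.1) fun x y hxy => mul_le_mul_of_nonneg_left hxy hε.le
  obtain ⟨z, hz, hmin⟩ := hlsc.exists_isMinOn ⟨0, h0S⟩ (h.isCompact_sublevel _)
  rw [isMinOn_iff] at hmin
  refine ⟨z, hz.1, le_antisymm ?_ (h.infConv_le hε f hz.1)⟩
  have : Nonempty Z := ⟨⟨z, hz.1⟩⟩
  refine le_ciInf fun w => ?_
  by_cases hw : w.1 ∈ S
  · exact hmin w hw
  · have hw' : p f ^ 2 / ε < Ψ w := by
      by_contra! hle
      exact hw ⟨w.2, hle⟩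
    rw [div_lt_iff₀' hε] at hw'
    have := hmin 0 h0S
    rw [_root_.map_zero, sub_zero, h.map_zero, mul_zero, add_zero] at this
    linarith [sq_nonneg (p (f - τ w))]

theorem convexOn_infConv [IsTopologicalAddGroup F] (h : IsPenalty Z Ψ) (hε : 0 < ε)
    (hp : LowerSemicontinuous p) (hτ : Continuous τ) :
    ConvexOn ℝ univ (infConv p τ Z Ψ ε) := by
  refine ⟨convex_univ, fun f _ g _ a b ha hb hab => ?_⟩
  obtain ⟨z, hz, hfz⟩ := h.exists_infConv_eq hε hp hτ f
  obtain ⟨w, hw, hgw⟩ := h.exists_infConv_eq hε hp hτ g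
  rw [← hfz, ← hgw]
  have h1 := h.infConv_le (p := p) (τ := τ) hε (a • f + b • g) (h.convex.1 hz hw ha hb hab)
  have h2 := (p.convexOn.pow (fun x _ => apply_nonneg p x) 2).2 (mem_univ (f - τ z))
    (mem_univ (g - τ w)) ha hb hab
  have h3 := h.convex.2 hz hw ha hb hab
  have h4 : a • f + b • g - τ (a • z + b • w) = a • (f - τ z) + b • (g - τ w) := by
    simp only [map_add, map_smul, smul_sub]
    abel
  rw [h4] at h1
  simp only [smul_eq_mul, Pi.pow_apply] at *
  nlinarith [mul_le_mul_of_nonneg_left h3 hε.le]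

theorem infConv_smul_le [IsTopologicalAddGroup F] (h : IsPenalty Z Ψ) (hε : 0 < ε)
    (hp : LowerSemicontinuous p) (hτ : Continuous τ) {c : ℝ} (hc : 0 ≤ c) (f : F) :
    infConv p τ Z Ψ ε (c • f) ≤ c ^ 2 * infConv p τ Z Ψ ε f := by
  obtain ⟨z, hz, hfz⟩ := h.exists_infConv_eq hε hp hτ f
  refine (h.infConv_le hε _ (h.smul_mem z hz c hc)).trans_eq ?_
  rw [← hfz, map_smul, ← smul_sub, map_smul_eq_mul, Real.norm_of_nonneg hc, h.smul z hz c hc]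
  ring

theorem infConv_neg_le [IsTopologicalAddGroup F] (h : IsPenalty Z Ψ) (hε : 0 < ε)
    (hp : LowerSemicontinuous p) (hτ : Continuous τ) {s : E → E} (hsZ : ∀ z ∈ Z, s z ∈ Z)
    (hsΨ : ∀ z ∈ Z, Ψ (s z) = Ψ z) (hsτ : ∀ z, τ (s z) = -τ z) (f : F) :
    infConv p τ Z Ψ ε (-f) ≤ infConv p τ Z Ψ ε f := by
  obtain ⟨z, hz, hfz⟩ := h.exists_infConv_eq hε hp hτ f
  refine (h.infConv_le hε _ (hsZ z hz)).trans_eq ?_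
  rw [← hfz, hsΨ z hz, hsτ, ← map_neg_eq_map p (f - τ z), neg_sub, sub_neg_eq_add, neg_add_eq_sub]

theorem infConv_smul [IsTopologicalAddGroup F] (h : IsPenalty Z Ψ) (hε : 0 < ε)
    (hp : LowerSemicontinuous p) (hτ : Continuous τ) {s : E → E} (hsZ : ∀ z ∈ Z, s z ∈ Z)
    (hsΨ : ∀ z ∈ Z, Ψ (s z) = Ψ z) (hsτ : ∀ z, τ (s z) = -τ z) (c : ℝ) (f : F) :
    infConv p τ Z Ψ ε (c • f) = c ^ 2 * infConv p τ Z Ψ ε f := by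
  have hle : ∀ (c : ℝ) f, infConv p τ Z Ψ ε (c • f) ≤ c ^ 2 * infConv p τ Z Ψ ε f := by
    intro c f
    rcases le_total 0 c with hc | hc
    · exact h.infConv_smul_le hε hp hτ hc f
    · have h1 := h.infConv_smul_le hε hp hτ (neg_nonneg.2 hc) f
      have h2 := h.infConv_neg_le hε hp hτ hsZ hsΨ hsτ (-c • f)
      rw [neg_smul, neg_neg] at h2
      rw [neg_smul, neg_sq] at h1
      exact h2.trans h1
  refine le_antisymm (hle c f) ?_
  rcases eq_or_ne c 0 with rfl | hc
  · simpa using h.infConv_nonneg hε 0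
  · have h1 := hle c⁻¹ (c • f)
    rw [smul_smul, inv_mul_cancel₀ hc, one_smul, inv_pow, le_inv_mul_iff₀ (by positivity)] at h1
    exact h1

/-- Since minimisers exist, a sublevel set is the projection of a closed set along the compact
factor `{Ψ ≤ r / ε}`, hence closed. -/
theorem lowerSemicontinuous_infConv [IsTopologicalAddGroup F] (h : IsPenalty Z Ψ) (hε : 0 < ε)
    (hp : LowerSemicontinuous p) (hτ : Continuous τ) :
    LowerSemicontinuous (infConv p τ Z Ψ ε) := by
  refine lowerSemicontinuous_iff_isClosed_preimage.2 fun r => ?_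
  have hcpt : CompactSpace {z ∈ Z | Ψ z ≤ r / ε} :=
    isCompact_iff_compactSpace.1 (h.isCompact_sublevel _)
  have hlsc : LowerSemicontinuous fun y : F × {z ∈ Z | Ψ z ≤ r / ε} =>
      p (y.1 - τ y.2) ^ 2 + ε * Ψ y.2 := by
    refine LowerSemicontinuous.add ?_ ?_
    · refine lowerSemicontinuousOn_univ_iff.1 (lowerSemicontinuousOn_sq ?_
        fun _ _ => apply_nonneg _ _)
      exact lowerSemicontinuousOn_univ_iff.2 (hp.comp
        (continuous_fst.sub (hτ.comp (continuous_subtype_val.comp continuous_snd))))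
    · refine (continuous_const_mul ε).comp_lowerSemicontinuous ?_
        fun x y hxy => mul_le_mul_of_nonneg_left hxy hε.le
      have h1 : LowerSemicontinuous fun z : {z ∈ Z | Ψ z ≤ r / ε} => Ψ z :=
        lowerSemicontinuous_restrict_iff.2 (h.lsc.mono fun z hz => hz.1)
      exact h1.comp continuous_snd
  have hcl := isClosedMap_fst_of_compactSpace _ (hlsc.isClosed_preimage r)
  convert hcl using 1
  ext f
  constructor
  · intro hf
    obtain ⟨z, hz, hfz⟩ := h.exists_infConv_eq hε hp hτ f
    have hle : p (f - τ z) ^ 2 + ε * Ψ z ≤ r := hfz.trans_le hf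
    refine ⟨(f, ⟨z, hz, ?_⟩), hle, rfl⟩
    rw [le_div_iff₀' hε]
    linarith [sq_nonneg (p (f - τ z))]
  · rintro ⟨⟨f, z⟩, hle, rfl⟩
    exact (h.infConv_le hε f z.2.1).trans hle

/-- The midpoint of minimisers `z`, `w` competes at the midpoint of `f`, `g`. Midpoint equality
leaves `Ψ` no convexity gain, so `z = w`, and the triangle inequality through `τ z` gives the bound.
-/
theorem seminorm_sub_le_of_infConv_midpoint [IsTopologicalAddGroup F] (h : IsPenalty Z Ψ)
    (hε : 0 < ε) (hp : LowerSemicontinuous p) (hτ : Continuous τ) {f g : F}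
    (hfg : (infConv p τ Z Ψ ε f + infConv p τ Z Ψ ε g) / 2 ≤
      infConv p τ Z Ψ ε ((1 / 2 : ℝ) • f + (1 / 2 : ℝ) • g)) :
    p (f - g) ≤ √(infConv p τ Z Ψ ε f) + √(infConv p τ Z Ψ ε g) := by
  obtain ⟨z, hz, hfz⟩ := h.exists_infConv_eq hε hp hτ f
  obtain ⟨w, hw, hgw⟩ := h.exists_infConv_eq hε hp hτ g
  have h2' : (0 : ℝ) ≤ 1 / 2 := by norm_num
  have h2'' : (1 / 2 : ℝ) + 1 / 2 = 1 := by norm_num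
  have h1 := h.infConv_le (p := p) (τ := τ) hε ((1 / 2 : ℝ) • f + (1 / 2 : ℝ) • g)
    (h.convex.1 hz hw h2' h2' h2'')
  have h2 := (p.convexOn.pow (fun x _ => apply_nonneg p x) 2).2 (mem_univ (f - τ z))
    (mem_univ (g - τ w)) h2' h2' h2''
  have h4 : (1 / 2 : ℝ) • f + (1 / 2 : ℝ) • g - τ ((1 / 2 : ℝ) • z + (1 / 2 : ℝ) • w) =
      (1 / 2 : ℝ) • (f - τ z) + (1 / 2 : ℝ) • (g - τ w) := by
    simp only [map_add, map_smul, smul_sub]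
    abel
  rw [h4] at h1
  simp only [smul_eq_mul, Pi.pow_apply] at h2
  have hzw : z = w := by
    refine h.strict z hz w hw (le_of_mul_le_mul_left ?_ hε)
    linarith
  subst hzw
  have h5 : ∀ f, p (f - τ z) ^ 2 + ε * Ψ z = infConv p τ Z Ψ ε f →
      p (f - τ z) ≤ √(infConv p τ Z Ψ ε f) := fun f hf =>
    Real.le_sqrt_of_sq_le (by linarith [mul_nonneg hε.le (h.nonneg z hz)])
  calc p (f - g) ≤ p (f - τ z) + p (g - τ z) := by
        have := map_sub_le_add p (f - τ z) (g - τ z)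
        rwa [sub_sub_sub_cancel_right] at this
    _ ≤ _ := add_le_add (h5 f hfz) (h5 g hgw)

end IsPenalty

end InfConvolution

/-! ### Assembly of the dual norm and the barycenter map. -/

section Assembly

variable {X : Type*} [NormedAddCommGroup X] [NormedSpace ℝ X]

theorem exists_isStrictlyConvex_of_isPenalty {E : Type*} [AddCommGroup E] [Module ℝ E]
    [TopologicalSpace E] {Z : Set E} {Ψ : E → ℝ} (h : IsPenalty Z Ψ) {τ : E →ₗ[ℝ] WeakDual ℝ X}
    (hτ : Continuous τ) {s : E → E} (hsZ : ∀ z ∈ Z, s z ∈ Z) (hsΨ : ∀ z ∈ Z, Ψ (s z) = Ψ z)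
    (hsτ : ∀ z, τ (s z) = -τ z) {p : Seminorm ℝ (StrongDual ℝ X)} (hp : IsNorm p)
    (hpn : IsCoarser p (normSeminorm ℝ (StrongDual ℝ X))) (hplsc : IsWeakStarLSC p)
    (hdense : ∀ f, ∀ δ > 0, ∃ z ∈ Z, p (f - WeakDual.toStrongDual (τ z)) < δ) :
    ∃ D : Seminorm ℝ (StrongDual ℝ X), IsEquivalentDualNorm D ∧ IsStrictlyConvex D := by
  obtain ⟨C, hC, hpC⟩ := hpn
  simp only [coe_normSeminorm] at hpC
  let W : WeakDual ℝ X →ₗ[ℝ] StrongDual ℝ X := WeakDual.toStrongDual.toLinearMap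
  set P : Seminorm ℝ (WeakDual ℝ X) := p.comp W
  set ν : Seminorm ℝ (WeakDual ℝ X) := (normSeminorm ℝ (StrongDual ℝ X)).comp W
  have hPlsc : LowerSemicontinuous P := hplsc
  have hνlsc : LowerSemicontinuous ν := isWeakStarLSC_norm
  let G : ℕ → WeakDual ℝ X → ℝ := fun n => infConv P τ Z Ψ (1 / ((n : ℝ) + 1))
  have hε : ∀ n : ℕ, 0 < 1 / ((n : ℝ) + 1) := fun n => by positivity
  have hG0 : ∀ n f, 0 ≤ G n f := fun n f => h.infConv_nonneg (hε n) f
  have hGle : ∀ n f, (1 / 2 : ℝ) ^ n * G n f ≤ (1 / 2 : ℝ) ^ n * (C * ν f) ^ 2 := fun n f => by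
    have h1 : G n f ≤ P f ^ 2 := h.infConv_le_sq (hε n) f
    have h2 : P f ≤ C * ν f := hpC (W f)
    have h3 := apply_nonneg P f
    gcongr
    exact h1.trans (by gcongr)
  have hsum : ∀ f, Summable fun n => (1 / 2 : ℝ) ^ n * G n f := fun f =>
    Summable.of_nonneg_of_le (fun n => mul_nonneg (by positivity) (hG0 n f)) (fun n => hGle n f)
      (summable_geometric_two.mul_right _)
  have hGconv : ∀ n, ConvexOn ℝ univ (G n) := fun n => h.convexOn_infConv (hε n) hPlsc hτ
  have hνconv : ConvexOn ℝ univ (fun f => ν f ^ 2) :=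
    ν.convexOn.pow (fun x _ => apply_nonneg ν x) 2
  -- The first term gives equivalence with the canonical norm, the series strict convexity.
  let Q : WeakDual ℝ X → ℝ := fun f => ν f ^ 2 + ∑' n, (1 / 2 : ℝ) ^ n * G n f
  have hQconv : ConvexOn ℝ univ Q := by
    refine hνconv.add ⟨convex_univ, fun f _ g _ a b ha hb hab => ?_⟩
    rw [smul_eq_mul, smul_eq_mul, ← tsum_mul_left, ← tsum_mul_left,
      ← ((hsum f).mul_left a).tsum_add ((hsum g).mul_left b)]
    refine (hsum _).tsum_le_tsum (fun n => ?_) (((hsum f).mul_left a).add ((hsum g).mul_left b))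
    have := (hGconv n).2 (mem_univ f) (mem_univ g) ha hb hab
    simp only [smul_eq_mul] at this
    calc _ ≤ (1 / 2 : ℝ) ^ n * (a * G n f + b * G n g) := by gcongr
      _ = _ := by ring
  have hQsmul : ∀ (c : ℝ) f, Q (c • f) = c ^ 2 * Q f := fun c f => by
    simp only [Q, mul_add, ← tsum_mul_left]
    congr 1
    · rw [map_smul_eq_mul, mul_pow, Real.norm_eq_abs, sq_abs]
    · congr 1
      ext n
      simp only [G]
      rw [h.infConv_smul (hε n) hPlsc hτ hsZ hsΨ hsτ]
      ring
  have hQlsc : LowerSemicontinuous Q := by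
    rw [← lowerSemicontinuousOn_univ_iff]
    refine LowerSemicontinuousOn.add (lowerSemicontinuousOn_sq (hνlsc.lowerSemicontinuousOn _)
      fun f _ => apply_nonneg ν f) (lowerSemicontinuousOn_real_tsum (fun n => ?_)
      (fun n f _ => mul_nonneg (by positivity) (hG0 n f)) fun f _ => hsum f)
    exact (continuous_const_mul ((1 / 2 : ℝ) ^ n)).comp_lowerSemicontinuousOn
      ((h.lowerSemicontinuous_infConv (hε n) hPlsc hτ).lowerSemicontinuousOn _)
      fun x y hxy => mul_le_mul_of_nonneg_left hxy (by positivity)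
  have hνQ : ∀ f, ν f ^ 2 ≤ Q f := fun f =>
    le_add_of_nonneg_right (tsum_nonneg fun n => mul_nonneg (by positivity) (hG0 n f))
  have hQν : ∀ f, Q f ≤ (1 + 2 * C ^ 2) * ν f ^ 2 := fun f => by
    have h1 := (hsum f).tsum_le_tsum (fun n => hGle n f) (summable_geometric_two.mul_right _)
    rw [tsum_mul_right, tsum_geometric_two] at h1
    simp only [Q]
    nlinarith
  obtain ⟨D, hD⟩ := exists_seminorm_eq_sqrt hQconv hQsmul
  have hDsq : ∀ f, D f ^ 2 = Q f := fun f => by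
    rw [hD, Real.sq_sqrt ((sq_nonneg _).trans (hνQ f))]
  refine ⟨D.comp StrongDual.toWeakDual.toLinearMap, ?_, ?_⟩
  · refine isEquivalentDualNorm_of_isWeakStarLSC ⟨⟨√(1 + 2 * C ^ 2), by positivity, fun f => ?_⟩,
      ⟨1, one_pos, fun f => ?_⟩⟩ ?_
    · change D (StrongDual.toWeakDual f) ≤ √(1 + 2 * C ^ 2) * ν (StrongDual.toWeakDual f)
      rw [hD, ← Real.sqrt_sq (apply_nonneg ν (StrongDual.toWeakDual f)),
        ← Real.sqrt_mul (by positivity)]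
      exact Real.sqrt_le_sqrt (by simpa using hQν (StrongDual.toWeakDual f))
    · change ν (StrongDual.toWeakDual f) ≤ 1 * D (StrongDual.toWeakDual f)
      rw [one_mul, hD]
      exact Real.le_sqrt_of_sq_le (hνQ _)
    · have h1 : LowerSemicontinuous fun f => √(Q f) :=
        Real.continuous_sqrt.comp_lowerSemicontinuous hQlsc fun _ _ => Real.sqrt_le_sqrt
      have h2 : (fun f => √(Q f)) = D := funext fun f => (hD f).symm
      rw [h2] at h1
      exact h1
  · intro f' g' hfg hfg'
    set f := StrongDual.toWeakDual f'
    set g := StrongDual.toWeakDual g'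
    change D f = D g at hfg
    change D g = D (f + g) / 2 at hfg'
    have hmid : (Q f + Q g) / 2 ≤ Q ((1 / 2 : ℝ) • f + (1 / 2 : ℝ) • g) := by
      rw [← smul_add, hQsmul, ← hDsq f, ← hDsq g, ← hDsq (f + g), hfg]
      have : D (f + g) = 2 * D g := by linarith
      rw [this]
      exact le_of_eq (by ring)
    have h2' : (0 : ℝ) ≤ 1 / 2 := by norm_num
    have h2'' : (1 / 2 : ℝ) + 1 / 2 = 1 := by norm_num
    have hνmid := hνconv.2 (mem_univ f) (mem_univ g) h2' h2' h2''
    simp only [smul_eq_mul] at hνmid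
    have hGmid := forall_le_of_tsum_le (((hsum f).add (hsum g)).div_const 2)
      (hsum ((1 / 2 : ℝ) • f + (1 / 2 : ℝ) • g)) (fun n => by
        have := (hGconv n).2 (mem_univ f) (mem_univ g) h2' h2' h2''
        simp only [smul_eq_mul] at this
        calc _ ≤ (1 / 2 : ℝ) ^ n * (1 / 2 * G n f + 1 / 2 * G n g) := by gcongr
          _ = _ := by ring) (by
        rw [tsum_div_const, (hsum f).tsum_add (hsum g)]
        simp only [Q] at hmid
        linarith)
    have hle : ∀ n, P (f - g) ≤ √(G n f) + √(G n g) := fun n => by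
      refine h.seminorm_sub_le_of_infConv_midpoint (hε n) hPlsc hτ ?_
      refine le_of_mul_le_mul_left (a := (1 / 2 : ℝ) ^ n) ?_ (by positivity)
      calc _ = _ := by ring
        _ ≤ _ := hGmid n
    have hlim : ∀ f, Tendsto (fun n => √(G n f)) atTop (𝓝 0) := fun f => by
      have := (h.tendsto_infConv (p := P) (τ := τ) (f := f) fun δ hδ => hdense (W f) δ hδ).sqrt
      rwa [Real.sqrt_zero] at this
    have h0 : P (f - g) ≤ 0 := by
      have := (hlim f).add (hlim g)
      rw [add_zero] at this
      exact ge_of_tendsto' this hle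
    exact sub_eq_zero.1 (hp _ (h0.antisymm (apply_nonneg P _)))

/-- The energy dominates the squared mass, which is at least the squared norm on the cone, so
sublevel sets are compact by Banach–Alaoglu and lower semicontinuity. -/
theorem IsStrictEnergy.isPenalty_prod {K : Type*} [TopologicalSpace K] [CompactSpace K]
    {Φ : WeakDual ℝ C(K, ℝ) → ℝ} (h : IsStrictEnergy Φ) :
    IsPenalty (positiveCone K ×ˢ positiveCone K) fun z => Φ z.1 + Φ z.2 := by
  have h0 : (0 : WeakDual ℝ C(K, ℝ)) ∈ positiveCone K := fun g _ => le_rfl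
  have hnn : ∀ Λ ∈ positiveCone K, 0 ≤ Φ Λ := fun Λ hΛ => (sq_nonneg _).trans (h.sq_mass_le Λ hΛ)
  have hlsc : LowerSemicontinuousOn
      (fun z : WeakDual ℝ C(K, ℝ) × WeakDual ℝ C(K, ℝ) => Φ z.1 + Φ z.2)
      (positiveCone K ×ˢ positiveCone K) :=
    (h.lsc.comp continuous_fst.continuousOn fun z hz => hz.1).add
      (h.lsc.comp continuous_snd.continuousOn fun z hz => hz.2)
  have hconv : ∀ z ∈ positiveCone K ×ˢ positiveCone K, ∀ w ∈ positiveCone K ×ˢ positiveCone K,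
      ∀ a b : ℝ, 0 ≤ a → 0 ≤ b → a + b = 1 →
      Φ (a • z.1 + b • w.1) ≤ a * Φ z.1 + b * Φ w.1 ∧
      Φ (a • z.2 + b • w.2) ≤ a * Φ z.2 + b * Φ w.2 := fun z hz w hw a b ha hb hab =>
    ⟨h.convex.2 hz.1 hw.1 ha hb hab, h.convex.2 hz.2 hw.2 ha hb hab⟩
  refine ⟨⟨h0, h0⟩, fun z hz c hc => ⟨smul_mem_positiveCone hz.1 hc, smul_mem_positiveCone hz.2 hc⟩,
    hlsc, ⟨convex_positiveCone.prod convex_positiveCone, fun z hz w hw a b ha hb hab => ?_⟩,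
    fun z hz => add_nonneg (hnn _ hz.1) (hnn _ hz.2), fun z hz c hc => ?_, fun c => ?_, ?_⟩
  · have := hconv z hz w hw a b ha hb hab
    simp only [smul_eq_mul, Prod.fst_add, Prod.snd_add, Prod.smul_fst, Prod.smul_snd]
    linarith
  · rw [Prod.smul_fst, Prod.smul_snd, h.smul _ hz.1 c hc, h.smul _ hz.2 c hc, mul_add]
  · let B : Set (WeakDual ℝ C(K, ℝ)) :=
      WeakDual.toStrongDual ⁻¹' Metric.closedBall (0 : StrongDual ℝ C(K, ℝ)) (√c)
    have hB : IsCompact (positiveCone K ∩ B) :=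
      (WeakDual.isCompact_closedBall 0 (√c)).inter_left isClosed_positiveCone
    have hmem : ∀ Λ ∈ positiveCone K, Φ Λ ≤ c → Λ ∈ B := fun Λ hΛ hc => by
      refine (mem_closedBall_zero_iff (E := StrongDual ℝ C(K, ℝ))).2 ?_
      exact (norm_toStrongDual_le_of_mem_positiveCone hΛ).trans
        (Real.le_sqrt_of_sq_le ((h.sq_mass_le Λ hΛ).trans hc))
    convert (hlsc.mono (prod_mono inter_subset_left inter_subset_left)).isCompact_inter_preimage_Iic
      (hB.prod hB) c using 1
    ext z
    constructor
    · rintro ⟨hz, hzc⟩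
      have h1 := hnn _ hz.1
      have h2 := hnn _ hz.2
      exact ⟨⟨⟨hz.1, hmem _ hz.1 (by linarith)⟩, hz.2, hmem _ hz.2 (by linarith)⟩, hzc⟩
    · rintro ⟨hz, hzc⟩
      exact ⟨⟨hz.1.1, hz.2.1⟩, hzc⟩
  · intro z hz w hw hzw
    have := hconv z hz w hw (1 / 2) (1 / 2) (by norm_num) (by norm_num) (by norm_num)
    simp only [Prod.fst_add, Prod.snd_add, Prod.smul_fst, Prod.smul_snd] at hzw
    exact Prod.ext (h.strict _ hz.1 _ hw.1 (by linarith)) (h.strict _ hz.2 _ hw.2 (by linarith))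

/-- Evaluation of the points of `X` on a `w*`-compact set. -/
theorem exists_evaluation_map [CompleteSpace X] {𝒦 : Set (WeakDual ℝ X)} (h𝒦 : IsCompact 𝒦) :
    ∃ J : X →L[ℝ] C(𝒦, ℝ), ∀ x (k : 𝒦), J x k = k.1 x := by
  obtain ⟨M, hM⟩ := banach_steinhaus (g := fun k : 𝒦 => WeakDual.toStrongDual k.1) fun x => by
    obtain ⟨M, hM⟩ := (h𝒦.image (WeakDual.eval_continuous x)).isBounded.exists_norm_le
    exact ⟨M, fun k => hM _ ⟨k.1, k.2, rfl⟩⟩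
  have : CompactSpace 𝒦 := isCompact_iff_compactSpace.1 h𝒦
  let L : X →ₗ[ℝ] C(𝒦, ℝ) :=
    { toFun := fun x => ⟨fun k => k.1 x, (WeakDual.eval_continuous x).comp continuous_subtype_val⟩
      map_add' := fun x y => ContinuousMap.ext fun k => map_add k.1 x y
      map_smul' := fun c x => ContinuousMap.ext fun k => map_smul k.1 c x }
  refine ⟨L.mkContinuous (max M 0) fun x => ?_, fun x k => rfl⟩
  refine (ContinuousMap.norm_le _ (by positivity)).2 fun k => ?_
  exact ((WeakDual.toStrongDual k.1).le_opNorm x).trans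
    (by gcongr; exact (hM k).trans (le_max_left _ _))

theorem exists_barycenter_map [CompleteSpace X] {𝒦 : Set (WeakDual ℝ X)} (h𝒦 : IsCompact 𝒦) :
    ∃ T : WeakDual ℝ C(𝒦, ℝ) →ₗ[ℝ] WeakDual ℝ X, Continuous T ∧
      ∀ k ∈ 𝒦, ∃ Λ ∈ positiveCone 𝒦, T Λ = k := by
  obtain ⟨J, hJ⟩ := exists_evaluation_map h𝒦
  have : CompactSpace 𝒦 := isCompact_iff_compactSpace.1 h𝒦
  let T : WeakDual ℝ C(𝒦, ℝ) →ₗ[ℝ] WeakDual ℝ X :=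
    { toFun := fun Λ => StrongDual.toWeakDual ((WeakDual.toStrongDual Λ).comp J)
      map_add' := fun _ _ => rfl
      map_smul' := fun _ _ => rfl }
  refine ⟨T, WeakDual.continuous_of_continuous_eval fun x => WeakDual.eval_continuous (J x),
    fun k hk => ⟨StrongDual.toWeakDual (ContinuousMap.evalCLM ℝ (⟨k, hk⟩ : 𝒦)), fun g hg => hg _, ?_⟩⟩
  exact DFunLike.ext _ _ fun x => hJ x ⟨k, hk⟩

theorem exists_mem_cone_sub_eq_of_mem_span {K : Type*} [TopologicalSpace K]
    {T : WeakDual ℝ C(K, ℝ) →ₗ[ℝ] WeakDual ℝ X} {𝒦 : Set (WeakDual ℝ X)}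
    (hT : ∀ k ∈ 𝒦, ∃ Λ ∈ positiveCone K, T Λ = k) {y : WeakDual ℝ X}
    (hy : y ∈ Submodule.span ℝ 𝒦) :
    ∃ z ∈ positiveCone K ×ˢ positiveCone K, T z.1 - T z.2 = y := by
  have h0 : (0 : WeakDual ℝ C(K, ℝ)) ∈ positiveCone K := fun g _ => le_rfl
  induction hy using Submodule.span_induction with
  | mem k hk =>
    obtain ⟨Λ, hΛ, rfl⟩ := hT k hk
    exact ⟨(Λ, 0), ⟨hΛ, h0⟩, by simp⟩
  | zero => exact ⟨(0, 0), ⟨h0, h0⟩, by simp⟩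
  | add x y _ _ hx hy =>
    obtain ⟨z, hz, rfl⟩ := hx
    obtain ⟨w, hw, rfl⟩ := hy
    refine ⟨z + w, ⟨add_mem_positiveCone hz.1 hw.1, add_mem_positiveCone hz.2 hw.2⟩, ?_⟩
    rw [Prod.fst_add, Prod.snd_add, map_add, map_add]
    abel
  | smul c x _ hx =>
    obtain ⟨z, hz, rfl⟩ := hx
    rcases le_total 0 c with hc | hc
    · refine ⟨c • z, ⟨smul_mem_positiveCone hz.1 hc, smul_mem_positiveCone hz.2 hc⟩, ?_⟩
      rw [Prod.smul_fst, Prod.smul_snd, map_smul, map_smul, smul_sub]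
    · refine ⟨(-c) • z.swap, ⟨smul_mem_positiveCone hz.2 (neg_nonneg.2 hc),
        smul_mem_positiveCone hz.1 (neg_nonneg.2 hc)⟩, ?_⟩
      rw [Prod.smul_fst, Prod.smul_snd, Prod.fst_swap, Prod.snd_swap, map_smul, map_smul, neg_smul,
        neg_smul, smul_sub]
      abel

end Assembly

end Renorming

theorem corollary2p9 {X : Type*} [NormedAddCommGroup X] [NormedSpace ℝ X] [CompleteSpace X]
    (K : Set (StrongDual ℝ X)) (hK : Renorming.IsWeakStarGruenhageCompact K)
    (q : Seminorm ℝ (StrongDual ℝ X)) (hq : Renorming.IsNorm q)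
    (hqp : ∃ p : Seminorm ℝ (StrongDual ℝ X), Renorming.IsNorm p ∧
      Renorming.IsCoarser p (normSeminorm ℝ (StrongDual ℝ X)) ∧
      Renorming.IsWeakStarLSC p ∧ Renorming.AreEquivalent q p)
    (hspan : Renorming.IsClosedSpan q K) :
    ∃ D : Seminorm ℝ (StrongDual ℝ X),
      Renorming.IsEquivalentDualNorm D ∧ Renorming.IsStrictlyConvex D := by
  obtain ⟨p, hp, hpn, hplsc, -, C, hC, hpq⟩ := hqp
  obtain ⟨hcpt, hgru⟩ := hK
  have : CompactSpace (StrongDual.toWeakDual '' K : Set (WeakDual ℝ X)) :=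
    isCompact_iff_compactSpace.1 hcpt
  obtain ⟨Φ, hΦ⟩ := Renorming.exists_isStrictEnergy hgru
  obtain ⟨T, hT, hTK⟩ := Renorming.exists_barycenter_map hcpt
  -- Swapping the two parts preserves the penalty and negates `τ`, which makes the inf-convolution
  -- even. Approximation within `δ / C` for `q` gives approximation within `δ` for `p`.
  refine Renorming.exists_isStrictlyConvex_of_isPenalty hΦ.isPenalty_prod
    (τ := T ∘ₗ LinearMap.fst ℝ _ _ - T ∘ₗ LinearMap.snd ℝ _ _)
    ((hT.comp continuous_fst).sub (hT.comp continuous_snd)) (s := Prod.swap)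
    (fun z hz => ⟨hz.2, hz.1⟩) (fun z _ => add_comm _ _) (fun z => (neg_sub _ _).symm) hp hpn hplsc
    fun f δ hδ => ?_
  obtain ⟨y, hy, hfy⟩ := hspan f (δ / C) (by positivity)
  have hy' : StrongDual.toWeakDual y ∈
      Submodule.span ℝ (StrongDual.toWeakDual '' K : Set (WeakDual ℝ X)) :=
    Submodule.apply_mem_span_image_of_mem_span (StrongDual.toWeakDual.toLinearMap) hy
  obtain ⟨z, hz, hzy⟩ := Renorming.exists_mem_cone_sub_eq_of_mem_span hTK hy'
  refine ⟨z, hz, ?_⟩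
  change p (f - WeakDual.toStrongDual (T z.1 - T z.2)) < δ
  rw [hzy, StrongDual.toStrongDual_toWeakDual]
  refine (hpq _).trans_lt ?_
  rwa [lt_div_iff₀' hC] at hfy
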